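/- Let $n\ge 1$, let $\mathrm{Sym}_n(\mathbb{R})$ be the space of real symmetric $n\times n$ matrices, and let $\mathcal{X}_n=\{[X]\in\mathbf{P}(\mathrm{Sym}_n(\mathbb{R})) : X>0\}$ be the projective model of the symmetric space $SL(n,\mathbb{R})/SO(n)$, identified with the hypersurface $\{X\in \mathrm{Sym}_n(\mathbb{R}) : X>0,\ \det X=1\}$ and equipped with the Riemannian metric $\langle A,B\rangle_X=\mathrm{tr}(X^{-1}AX^{-1}B)$ of that hypersurface. Let $\overline{\mathcal{X}_n}=\{[X]\in\mathbf{P}(\mathrm{Sym}_n(\mathbb{R})) : X\ge 0\}$ be its standard Satake compactification. Let $\mathbf{D}\subset\mathbf{P}(\mathrm{Sym}_n(\mathbb{R}))$ be a finitely-sided projective convex polytope, i.e. the set of classes $[X]$ of the nonzero elements $X$ of a convex cone in $\mathrm{Sym}_n(\mathbb{R})$ defined by finitely many linear inequalities $\ell(X)\ge 0$. Assume that $\mathbf{D}$ is full-dimensional (it has nonempty interior in $\mathbf{P}(\mathrm{Sym}_n(\mathbb{R}))$) and that its restriction $D=\mathbf{D}\cap\mathcal{X}_n$ is nonempty. Then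 $D$ has finite Riemannian volume in $\mathcal{X}_n$ if and only if $\mathbf{D}\subset\overline{\mathcal{X}_n}$. -/

import Mathlib

open MeasureTheory
open scoped LinearAlgebra.Projectivization

noncomputable section

namespace SatakePolytope

/-- `Sym_n(ℝ)`: the real vector space of symmetric `n × n` real matrices. -/
def SymMat (n : ℕ) : Submodule ℝ (Matrix (Fin n) (Fin n) ℝ) where
  carrier := {A | A.IsSymm}
  add_mem' := fun ha hb => ha.add hb
  zero_mem' := Matrix.isSymm_zero
  smul_mem' := fun c _ ha => ha.smul c

/-- The projective model of the symmetric space `SL(n,ℝ)/SO(n)`: the classes `[X]` with `X > 0`. -/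
def projModel (n : ℕ) : Set (ℙ ℝ (SymMat n)) :=
  {p | ∃ (X : SymMat n) (hX : X ≠ 0),
    (X : Matrix (Fin n) (Fin n) ℝ).PosDef ∧ p = Projectivization.mk ℝ X hX}

/-- The standard Satake compactification: the classes `[X]` with `X ≥ 0`. -/
def satakeCompactification (n : ℕ) : Set (ℙ ℝ (SymMat n)) :=
  {p | ∃ (X : SymMat n) (hX : X ≠ 0),
    (X : Matrix (Fin n) (Fin n) ℝ).PosSemidef ∧ p = Projectivization.mk ℝ X hX}

/-- Finitely-sided projective convex polytopes: the images in `P(Sym_n(ℝ))` of the convex cones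
cut out of `Sym_n(ℝ)` by finitely many linear inequalities. -/
def IsProjPolytope {n : ℕ} (P : Set (ℙ ℝ (SymMat n))) : Prop :=
  ∃ s : Finset (Module.Dual ℝ (SymMat n)),
    P = {p | ∃ (X : SymMat n) (hX : X ≠ 0),
      (∀ l ∈ s, 0 ≤ l X) ∧ p = Projectivization.mk ℝ X hX}

/-- The set of all nonzero representatives of the points of a subset of `P(Sym_n(ℝ))`, that is,
its preimage under the projection `Sym_n(ℝ) ∖ {0} → P(Sym_n(ℝ))`. -/
def representatives {n : ℕ} (P : Set (ℙ ℝ (SymMat n))) : Set (SymMat n) :=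
  {X | ∃ hX : X ≠ 0, Projectivization.mk ℝ X hX ∈ P}

/-- Full-dimensionality: nonempty interior for the quotient topology of `P(Sym_n(ℝ))`. -/
def IsFullDimensional {n : ℕ} (P : Set (ℙ ℝ (SymMat n))) : Prop :=
  (interior (representatives P)).Nonempty

/-- The hypersurface model of `SL(n,ℝ)/SO(n)`: `X > 0` with `det X = 1`. -/
def hypModel (n : ℕ) : Set (Matrix (Fin n) (Fin n) ℝ) :=
  {X | X.PosDef ∧ X.det = 1}

/-- The Riemannian metric `⟨A, B⟩_X = tr (X⁻¹ A X⁻¹ B)` of the hypersurface model. -/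
def metricTensor {n : ℕ} (X A B : Matrix (Fin n) (Fin n) ℝ) : ℝ :=
  (X⁻¹ * A * X⁻¹ * B).trace

/-- The part of the hypersurface model that corresponds to a subset of `P(Sym_n(ℝ))` under the
identification `X ↦ [X]` of the hypersurface model with the projective model. -/
def toHypModel {n : ℕ} (P : Set (ℙ ℝ (SymMat n))) : Set (Matrix (Fin n) (Fin n) ℝ) :=
  {X | X ∈ hypModel n ∧ ∃ Y ∈ representatives P, (Y : Matrix (Fin n) (Fin n) ℝ) = X}

/-- Index set of the affine coordinates `x_ij`, `i ≤ j`, `(i, j) ≠ (0, 0)`. -/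
abbrev CoordIdx (n : ℕ) : Type :=
  {p : Fin n × Fin n // p.1 ≤ p.2 ∧ (p.2 : ℕ) ≠ 0}

/-- The symmetric matrix whose upper left entry is `1` and whose other entries
are given by the coordinates `x`. -/
def affineMatrix {n : ℕ} (x : CoordIdx n → ℝ) : Matrix (Fin n) (Fin n) ℝ :=
  Matrix.of fun i j =>
    if h : ((max i j : Fin n) : ℕ) ≠ 0 then x ⟨(min i j, max i j), min_le_max, h⟩ else 1

/-- The global parametrization of the hypersurface model by the affine coordinates
`x_ij / x_00` of the projective model: the class `[M]` corresponds to `(det M)^(-1/n) M`.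
It is a diffeomorphism from the open set of all `x` with `affineMatrix x > 0`
onto the hypersurface model. -/
def hypParam {n : ℕ} (x : CoordIdx n → ℝ) : Matrix (Fin n) (Fin n) ℝ :=
  ((affineMatrix x).det ^ (-(1 : ℝ) / (n : ℝ))) • affineMatrix x

/-- The coordinate vector field `∂/∂x_a` of the parametrization `hypParam`. -/
def coordField {n : ℕ} (a : CoordIdx n) (x : CoordIdx n → ℝ) : Matrix (Fin n) (Fin n) ℝ :=
  Matrix.of fun i j => lineDeriv ℝ (fun y => hypParam y i j) x (Pi.single a 1)

/-- The matrix `(g_ab)` of the Riemannian metric in the coordinates `x`. -/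
def gramMatrix {n : ℕ} (x : CoordIdx n → ℝ) : Matrix (CoordIdx n) (CoordIdx n) ℝ :=
  Matrix.of fun a b => metricTensor (hypParam x) (coordField a x) (coordField b x)

/-- The Riemannian volume of a subset `S` of the hypersurface model, computed in the global
chart `hypParam`: the integral of `√(det (g_ab))` against Lebesgue measure. -/
def riemannianVolume {n : ℕ} (S : Set (Matrix (Fin n) (Fin n) ℝ)) : ENNReal :=
  ∫⁻ x in {x : CoordIdx n → ℝ | (affineMatrix x).PosDef ∧ hypParam x ∈ S},
    ENNReal.ofReal (Real.sqrt (gramMatrix x).det)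

end SatakePolytope

end

noncomputable section

namespace SatakePolytope

open Matrix Set Filter Topology

/-! The question is moved to the cone over the polytope. On the cone of positive definite matrices
the measure det^(-(n+1)/2) dv is invariant under all congruences v ↦ g v gᵀ
(`invMeasure_preimage_congrAction`), in particular under scaling. In the chart x_00 = 1 the
Riemannian density is a constant multiple of the same function (`sqrt_det_gramMatrix`), and
thickening the slice to 1 ≤ x_00 < 2 only brings in the factor ∫ da/a. So finite volume means finite
invariant measure of this slab of the cone (`lintegral_slice_lt_top_iff`). Scaling invariance allows
x_00 to be exchanged for other functions that are homogeneous of degree one and positive on the cone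
(`invMeasure_slice_le`).

Suppose n ≥ 2 and the cone leaves the closed positive cone. A segment from a positive definite
interior point then meets the boundary of the positive cone at a nonzero singular W that is interior
to the polyhedral cone (`exists_boundary_mem_interior`). Congruences contracting the kernel of W
carry a small open set to infinitely many disjoint sets of equal measure that accumulate at W, so
every neighbourhood of W has infinite measure (`invMeasure_eq_top_of_mem_nhds`).

Suppose the cone is positive semidefinite. It is covered by finitely many simplicial cones with
semidefinite generators X_i (`exists_simplicial_cover`). Write each X_i as a sum of squares x xᵀ,
and choose among these vectors a basis of maximal weight for the coordinates t_i. The determinant of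
∑ t_i X_i is at least a constant times the product of the basis weights. At every level a, the
independent X_i with t_i ≥ a live on the span of the r basis vectors of weight at least a, so there
are at most r(r+1)/2 of them. Summed over all levels, this bounds the density by a multiple of ∏
t_i^(-(n+1)/(n+2)), which is integrable because the exponent exceeds -1 (`exists_det_rpow_le`,
`invMeasure_simplicial_lt_top`). -/

/-! ### Coordinates on symmetric matrices and the congruence action -/

/-- Index set of the coordinates `x_ij`, `i ≤ j`, on `Sym_n(ℝ)`. -/
abbrev FullIdx (n : ℕ) : Type := Unit ⊕ CoordIdx n

/-- The coordinate which gives the entry in position `(i, j)` of a symmetric matrix. -/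
def entryIdx {n : ℕ} (i j : Fin n) : FullIdx n :=
  if h : ((max i j : Fin n) : ℕ) ≠ 0 then Sum.inr ⟨(min i j, max i j), min_le_max, h⟩
  else Sum.inl ()

/-- The position `(i, j)`, `i ≤ j`, of a coordinate. -/
def position {n : ℕ} [NeZero n] : FullIdx n → Fin n × Fin n :=
  Sum.elim (fun _ => (0, 0)) (fun a => a.1)

/-- The symmetric matrix with given coordinates. -/
def symOf {n : ℕ} : (FullIdx n → ℝ) →ₗ[ℝ] Matrix (Fin n) (Fin n) ℝ where
  toFun v := Matrix.of fun i j => v (entryIdx i j)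
  map_add' _ _ := rfl
  map_smul' _ _ := rfl

/-- The coordinates of a matrix on and above the diagonal. -/
def coords {n : ℕ} [NeZero n] : Matrix (Fin n) (Fin n) ℝ →ₗ[ℝ] (FullIdx n → ℝ) where
  toFun A := fun a => A (position a).1 (position a).2
  map_add' _ _ := rfl
  map_smul' _ _ := rfl

@[simp] lemma symOf_apply {n : ℕ} (v : FullIdx n → ℝ) (i j : Fin n) :
    symOf v i j = v (entryIdx i j) := rfl

@[simp] lemma coords_apply {n : ℕ} [NeZero n] (A : Matrix (Fin n) (Fin n) ℝ) (a : FullIdx n) :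
    coords A a = A (position a).1 (position a).2 := rfl

lemma entryIdx_comm {n : ℕ} (i j : Fin n) : entryIdx i j = entryIdx j i := by
  simp only [entryIdx, max_comm i j, min_comm i j]

lemma entryIdx_position {n : ℕ} [NeZero n] (a : FullIdx n) :
    entryIdx (position a).1 (position a).2 = a := by
  rcases a with ⟨⟩ | ⟨⟨i, j⟩, hij, hj⟩
  · simp [entryIdx, position]
  · simp only at hij hj
    have : ¬ j = 0 := fun h => hj (by simp [h])
    simp [entryIdx, position, max_eq_right hij, min_eq_left hij, this]

lemma position_entryIdx {n : ℕ} [NeZero n] (i j : Fin n) :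
    position (entryIdx i j) = (min i j, max i j) := by
  by_cases h : ((max i j : Fin n) : ℕ) ≠ 0
  · rw [entryIdx, dif_pos h]; rfl
  · rw [entryIdx, dif_neg h]
    have h0 : max i j = 0 := by
      apply Fin.ext
      simpa using h
    have h1 : min i j = 0 := le_antisymm ((min_le_max).trans h0.le) (Fin.zero_le _)
    simp [position, h0, h1]

lemma position_le {n : ℕ} [NeZero n] (a : FullIdx n) : (position a).1 ≤ (position a).2 := by
  rcases a with ⟨⟩ | ⟨⟨i, j⟩, hij, hj⟩
  · simp [position]
  · exact hij

/-- The coordinates are indexed by the positions on and above the diagonal. -/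
def positionEquiv {n : ℕ} [NeZero n] : FullIdx n ≃ {p : Fin n × Fin n // p.1 ≤ p.2} where
  toFun a := ⟨position a, position_le a⟩
  invFun p := entryIdx p.1.1 p.1.2
  left_inv a := entryIdx_position a
  right_inv p := by
    apply Subtype.ext
    change position (entryIdx p.1.1 p.1.2) = p.1
    rw [position_entryIdx, min_eq_left p.2, max_eq_right p.2]

lemma isSymm_symOf {n : ℕ} (v : FullIdx n → ℝ) : (symOf v).IsSymm := by
  ext i j
  simp [entryIdx_comm i j]

@[simp] lemma coords_symOf {n : ℕ} [NeZero n] (v : FullIdx n → ℝ) : coords (symOf v) = v := by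
  ext a
  simp [entryIdx_position]

lemma symOf_coords {n : ℕ} [NeZero n] {A : Matrix (Fin n) (Fin n) ℝ} (hA : A.IsSymm) :
    symOf (coords A) = A := by
  ext i j
  rw [symOf_apply, coords_apply, position_entryIdx]
  rcases le_total i j with h | h
  · simp [h]
  · simp [h, hA.apply]

lemma symOf_injective {n : ℕ} [NeZero n] :
    Function.Injective (symOf : (FullIdx n → ℝ) → Matrix (Fin n) (Fin n) ℝ) :=
  Function.LeftInverse.injective coords_symOf

lemma affineMatrix_eq_symOf {n : ℕ} (x : CoordIdx n → ℝ) :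
    affineMatrix x = symOf (Sum.elim (fun _ => 1) x) := by
  ext i j
  simp only [affineMatrix, symOf_apply, entryIdx, Matrix.of_apply]
  split_ifs <;> rfl

/-- The action `v ↦ g v gᵀ` of a matrix on `Sym_n(ℝ)`, in coordinates. -/
def congrAction {n : ℕ} [NeZero n] (g : Matrix (Fin n) (Fin n) ℝ) :
    (FullIdx n → ℝ) →ₗ[ℝ] (FullIdx n → ℝ) where
  toFun v := coords (g * symOf v * gᵀ)
  map_add' v w := by rw [map_add, mul_add, add_mul, map_add]
  map_smul' c v := by simp

lemma symOf_congrAction {n : ℕ} [NeZero n] (g : Matrix (Fin n) (Fin n) ℝ) (v : FullIdx n → ℝ) :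
    symOf (congrAction g v) = g * symOf v * gᵀ := by
  refine symOf_coords (A := g * symOf v * gᵀ) ?_
  rw [Matrix.IsSymm, Matrix.transpose_mul, Matrix.transpose_mul, (isSymm_symOf v).eq,
    Matrix.transpose_transpose, Matrix.mul_assoc]

lemma congrAction_mul {n : ℕ} [NeZero n] (g h : Matrix (Fin n) (Fin n) ℝ) :
    congrAction (g * h) = congrAction g ∘ₗ congrAction h := by
  refine LinearMap.ext fun v => (symOf_injective (n := n)) ?_
  simp only [LinearMap.comp_apply, symOf_congrAction, Matrix.transpose_mul, Matrix.mul_assoc]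

lemma congrAction_one {n : ℕ} [NeZero n] :
    congrAction (1 : Matrix (Fin n) (Fin n) ℝ) = LinearMap.id := by
  refine LinearMap.ext fun v => (symOf_injective (n := n)) ?_
  simp [symOf_congrAction]

/-- Reflecting the second factor turns the pairs i ≤ j into i ≥ j. Together the two halves run over
all n² pairs and once more over the diagonal, whence the exponent n + 1. -/
lemma prod_position {n : ℕ} [NeZero n] (d : Fin n → ℝ) :
    ∏ a : FullIdx n, d (position a).1 * d (position a).2 = (∏ i, d i) ^ (n + 1) := by
  have key : ∀ f : Fin n × Fin n → ℝ,
      ∏ a : FullIdx n, f (position a) = ∏ p : Fin n × Fin n with p.1 ≤ p.2, f p := fun f => by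
    rw [Finset.prod_subtype (p := fun p : Fin n × Fin n => p.1 ≤ p.2) _ (by simp) f]
    exact Fintype.prod_equiv positionEquiv _ _ (fun _ => rfl)
  rw [Finset.prod_mul_distrib, key (fun p => d p.1), key (fun p => d p.2)]
  have hswap : ∏ p : Fin n × Fin n with p.1 ≤ p.2, d p.2
      = ∏ p : Fin n × Fin n with p.2 ≤ p.1, d p.1 :=
    Finset.prod_equiv (Equiv.prodComm _ _) (by simp) (by simp)
  have hsplit : ∏ p : Fin n × Fin n with p.2 ≤ p.1, d p.1
      = (∏ p : Fin n × Fin n with ¬ p.1 ≤ p.2, d p.1) *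
        ∏ p : Fin n × Fin n with p.1 = p.2, d p.1 := by
    rw [← Finset.prod_union]
    · congr 1
      ext p
      simp only [Finset.mem_filter, Finset.mem_univ, true_and, Finset.mem_union, not_le]
      constructor
      · intro h; exact h.lt_or_eq.imp id Eq.symm
      · rintro (h | h)
        · exact h.le
        · exact h.ge
    · refine Finset.disjoint_filter.2 fun p _ h h' => h h'.le
  have hdiag : ∏ p : Fin n × Fin n with p.1 = p.2, d p.1 = ∏ i, d i := by
    refine Finset.prod_bij' (fun p _ => p.1) (fun i _ => (i, i)) ?_ ?_ ?_ ?_ ?_ <;> simp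
  rw [hswap, hsplit, ← mul_assoc, Finset.prod_filter_mul_prod_filter_not, hdiag,
    Fintype.prod_prod_type, pow_succ]
  simp [Finset.prod_pow]

/-- Compare the exponents of 2 in `prod_position` for the constant family 2. -/
lemma card_fullIdx {n : ℕ} [NeZero n] : 2 * Fintype.card (FullIdx n) = n * (n + 1) := by
  have h := prod_position (n := n) (fun _ => (2 : ℝ))
  simp only [Finset.prod_const, Finset.card_univ, Fintype.card_fin] at h
  rw [← pow_two, ← pow_mul, ← pow_mul] at h
  exact_mod_cast pow_right_injective₀ (by norm_num : (0 : ℝ) < 2) (by norm_num) h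

lemma det_congrAction_diagonal {n : ℕ} [NeZero n] (d : Fin n → ℝ) :
    LinearMap.det (congrAction (Matrix.diagonal d)) = (∏ i, d i) ^ (n + 1) := by
  have h : LinearMap.toMatrix' (congrAction (Matrix.diagonal d))
      = Matrix.diagonal fun a => d (position a).1 * d (position a).2 := by
    ext a b
    rw [LinearMap.toMatrix'_apply]
    simp only [congrAction, LinearMap.coe_mk, AddHom.coe_mk, coords_apply,
      Matrix.diagonal_transpose, Matrix.mul_diagonal, Matrix.diagonal_mul, symOf_apply,
      entryIdx_position]
    rw [Matrix.diagonal_apply]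
    by_cases hab : a = b
    · subst hab; simp
    · simp [hab]
  rw [← LinearMap.det_toMatrix', h, Matrix.det_diagonal, prod_position]

/-! ### Gram determinant of the trace form and the Jacobian of congruences -/

/-- The Gram matrix of the form `tr (M⁻¹ A M⁻¹ B)` in the standard basis of `Sym_n(ℝ)`. -/
def fullGram {n : ℕ} (M : Matrix (Fin n) (Fin n) ℝ) : Matrix (FullIdx n) (FullIdx n) ℝ :=
  Matrix.of fun a b => metricTensor M (symOf (Pi.single a 1)) (symOf (Pi.single b 1))

/-- `metricTensor M` as a bilinear form on coordinates. -/
def metricForm {n : ℕ} (M : Matrix (Fin n) (Fin n) ℝ) :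
    LinearMap.BilinForm ℝ (FullIdx n → ℝ) :=
  LinearMap.mk₂ ℝ (fun v w => metricTensor M (symOf v) (symOf w))
    (fun _ _ _ => by simp [metricTensor, mul_add, add_mul])
    (fun _ _ _ => by simp [metricTensor])
    (fun _ _ _ => by simp [metricTensor, mul_add])
    (fun _ _ _ => by simp [metricTensor])

lemma metricForm_apply {n : ℕ} (M : Matrix (Fin n) (Fin n) ℝ) (v w : FullIdx n → ℝ) :
    metricForm M v w = metricTensor M (symOf v) (symOf w) := rfl

lemma fullGram_eq {n : ℕ} (M : Matrix (Fin n) (Fin n) ℝ) :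
    fullGram M = LinearMap.BilinForm.toMatrix' (metricForm M) := by
  ext a b
  simp [fullGram, metricForm_apply, LinearMap.BilinForm.toMatrix'_apply]

lemma metricTensor_congr {n : ℕ} (g : Matrix (Fin n) (Fin n) ℝ) (hg : IsUnit g.det)
    (M A B : Matrix (Fin n) (Fin n) ℝ) :
    metricTensor (g * M * gᵀ) (g * A * gᵀ) (g * B * gᵀ) = metricTensor M A B := by
  have hgt : IsUnit gᵀ.det := by rwa [Matrix.det_transpose]
  unfold metricTensor
  rw [Matrix.mul_inv_rev, Matrix.mul_inv_rev]
  have : gᵀ⁻¹ * (M⁻¹ * g⁻¹) * (g * A * gᵀ) * (gᵀ⁻¹ * (M⁻¹ * g⁻¹)) * (g * B * gᵀ)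
      = gᵀ⁻¹ * (M⁻¹ * A * M⁻¹ * B * gᵀ) := by
    calc _ = gᵀ⁻¹ * (M⁻¹ * ((g⁻¹ * g) * A * (gᵀ * gᵀ⁻¹) * M⁻¹ * (g⁻¹ * g) * B * gᵀ)) := by
          simp only [Matrix.mul_assoc]
      _ = _ := by
          rw [Matrix.nonsing_inv_mul _ hg, Matrix.mul_nonsing_inv _ hgt]
          simp only [Matrix.mul_assoc, Matrix.one_mul, Matrix.mul_one]
  rw [this, Matrix.trace_mul_comm, Matrix.mul_assoc, Matrix.mul_nonsing_inv _ hgt, Matrix.mul_one]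

/-- Congruence by `g` is an isometry from the form at `M` to the form at `g * M * gᵀ`. -/
lemma det_fullGram_congr {n : ℕ} [NeZero n] (g : Matrix (Fin n) (Fin n) ℝ) (hg : IsUnit g.det)
    (M : Matrix (Fin n) (Fin n) ℝ) :
    LinearMap.det (congrAction g) ^ 2 * (fullGram (g * M * gᵀ)).det = (fullGram M).det := by
  have h : (metricForm (g * M * gᵀ)).comp (congrAction g) (congrAction g) = metricForm M := by
    ext a b
    simp [metricForm_apply, symOf_congrAction, metricTensor_congr g hg]
  rw [fullGram_eq, fullGram_eq, ← h, LinearMap.BilinForm.toMatrix'_comp, Matrix.det_mul,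
    Matrix.det_mul, Matrix.det_transpose, LinearMap.det_toMatrix']
  ring

lemma det_fullGram_one_pos {n : ℕ} [NeZero n] :
    0 < (fullGram (1 : Matrix (Fin n) (Fin n) ℝ)).det := by
  have hpos : (fullGram (1 : Matrix (Fin n) (Fin n) ℝ)).PosDef := by
    have hform : ∀ v w : FullIdx n → ℝ, v ⬝ᵥ (fullGram 1 *ᵥ w) = (symOf v * symOf w).trace := by
      intro v w
      rw [fullGram_eq, ← Matrix.toBilin'_apply', Matrix.toBilin'_toMatrix']
      simp [metricForm_apply, metricTensor]
    rw [Matrix.posDef_iff_dotProduct_mulVec]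
    refine ⟨?_, fun {v} hv => ?_⟩
    · ext a b
      simp [fullGram, metricTensor, Matrix.trace_mul_comm (symOf (Pi.single a 1))]
    · rw [star_trivial, hform]
      have h2 : symOf v * symOf v = (symOf v)ᴴ * symOf v := by
        rw [Matrix.conjTranspose_eq_transpose_of_trivial, (isSymm_symOf v).eq]
      rw [h2]
      refine lt_of_le_of_ne (Matrix.posSemidef_conjTranspose_mul_self _).trace_nonneg
        fun h0 => hv ?_
      apply symOf_injective
      rw [map_zero]
      exact Matrix.trace_conjTranspose_mul_self_eq_zero_iff.1 h0.symm
  exact hpos.det_pos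

lemma exists_orthogonal_diagonal {n : ℕ} {M : Matrix (Fin n) (Fin n) ℝ} (hM : M.IsHermitian) :
    ∃ Q : Matrix (Fin n) (Fin n) ℝ, Q * Qᵀ = 1 ∧
      M = Q * Matrix.diagonal hM.eigenvalues * Qᵀ := by
  refine ⟨(hM.eigenvectorUnitary : Matrix (Fin n) (Fin n) ℝ), ?_, ?_⟩
  · have := Unitary.coe_mul_star_self hM.eigenvectorUnitary
    rwa [Unitary.coe_star, Matrix.star_eq_conjTranspose,
      Matrix.conjTranspose_eq_transpose_of_trivial] at this
  · have := hM.spectral_theorem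
    rw [Unitary.conjStarAlgAut_apply, Matrix.star_eq_conjTranspose,
      Matrix.conjTranspose_eq_transpose_of_trivial] at this
    exact this

/-- An orthogonal matrix fixes the base point 1, so `det_fullGram_congr` compares the nonzero Gram
determinant there with itself. -/
lemma det_congrAction_orthogonal_sq {n : ℕ} [NeZero n] {Q : Matrix (Fin n) (Fin n) ℝ}
    (hQ : Q * Qᵀ = 1) : LinearMap.det (congrAction Q) ^ 2 = 1 := by
  have hdet : IsUnit Q.det := by
    have h := congrArg Matrix.det hQ
    rw [Matrix.det_mul, Matrix.det_one] at h
    exact IsUnit.of_mul_eq_one _ h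
  have h := det_fullGram_congr Q hdet 1
  rw [Matrix.mul_one, hQ] at h
  exact mul_right_cancel₀ (det_fullGram_one_pos (n := n)).ne' (by rw [h, one_mul])

/-- Transport from the base point by an orthogonal matrix times the square roots of the eigenvalues;
only congruences whose squared determinant is already known are used. -/
lemma det_fullGram {n : ℕ} [NeZero n] {M : Matrix (Fin n) (Fin n) ℝ} (hM : M.PosDef) :
    M.det ^ (n + 1) * (fullGram M).det = (fullGram (1 : Matrix (Fin n) (Fin n) ℝ)).det := by
  obtain ⟨Q, hQ, hMQ⟩ := exists_orthogonal_diagonal hM.1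
  set l := hM.1.eigenvalues
  have hl : ∀ i, 0 < l i := hM.eigenvalues_pos
  set D := Matrix.diagonal fun i => Real.sqrt (l i)
  have hDD : D * Dᵀ = Matrix.diagonal l := by
    simp [D, Matrix.diagonal_transpose, Real.mul_self_sqrt (hl _).le]
  have hM' : M = (Q * D) * 1 * (Q * D)ᵀ := by
    rw [Matrix.mul_one, Matrix.transpose_mul, Matrix.mul_assoc, ← Matrix.mul_assoc D, hDD,
      ← Matrix.mul_assoc, ← hMQ]
  have hQ2 : Q.det ^ 2 = 1 := by
    have h := congrArg Matrix.det hQ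
    rwa [Matrix.det_mul, Matrix.det_transpose, Matrix.det_one, ← pow_two] at h
  have hdetM : M.det = (∏ i, Real.sqrt (l i)) ^ 2 := by
    rw [hM', Matrix.mul_one, Matrix.det_mul, Matrix.det_transpose, Matrix.det_mul,
      Matrix.det_diagonal, ← pow_two, mul_pow, hQ2, one_mul]
  have hu : IsUnit (Q * D).det := by
    rw [isUnit_iff_ne_zero, Matrix.det_mul, Matrix.det_diagonal]
    refine mul_ne_zero (fun h => by simp [h] at hQ2) ?_
    exact Finset.prod_ne_zero_iff.2 fun i _ => (Real.sqrt_pos.2 (hl i)).ne'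
  have h := det_fullGram_congr (Q * D) hu 1
  rw [← hM', congrAction_mul, LinearMap.det_comp, mul_pow, det_congrAction_orthogonal_sq hQ,
    one_mul, det_congrAction_diagonal] at h
  rw [← h, hdetM]
  ring

/-- `det_fullGram_congr` and `det_fullGram` both evaluate the Gram determinant at `g * gᵀ`;
comparing them gives the Jacobian without decomposing `g`. -/
lemma abs_det_congrAction {n : ℕ} [NeZero n] {g : Matrix (Fin n) (Fin n) ℝ} (hg : g.det ≠ 0) :
    |LinearMap.det (congrAction g)| = |g.det| ^ (n + 1) := by
  have hpd : (g * 1 * gᵀ).PosDef := by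
    rw [Matrix.mul_one, ← Matrix.conjTranspose_eq_transpose_of_trivial]
    exact Matrix.PosDef.mul_conjTranspose_self g
      (Matrix.vecMul_injective_iff_isUnit.2 ((Matrix.isUnit_iff_isUnit_det g).2 hg.isUnit))
  have h1 := det_fullGram_congr g hg.isUnit 1
  have h2 := det_fullGram hpd
  have hpos := det_fullGram_one_pos (n := n)
  rw [← h2] at h1
  have hne : (fullGram (g * 1 * gᵀ)).det ≠ 0 := by
    intro h0
    rw [h0, mul_zero] at h2
    exact hpos.ne h2
  have h3 := mul_right_cancel₀ hne h1
  rw [Matrix.mul_one, Matrix.det_mul, Matrix.det_transpose] at h3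
  rw [← pow_left_inj₀ (abs_nonneg _) (by positivity) two_ne_zero, sq_abs, h3, ← pow_mul,
    mul_comm (n + 1), pow_mul, sq_abs, pow_two]

/-! ### The Riemannian volume density in the affine chart -/

/-- Factor out `M` and expand det(1 + t M⁻¹E) = 1 + t tr(M⁻¹E) + t² p(t) with a polynomial p. -/
lemma hasDerivAt_det_line {n : ℕ} (M E : Matrix (Fin n) (Fin n) ℝ) (hM : IsUnit M.det) :
    HasDerivAt (fun t : ℝ => (M + t • E).det) (M.det * (M⁻¹ * E).trace) 0 := by
  have h : (fun t : ℝ => (M + t • E).det) = fun t : ℝ => M.det * (1 + (M⁻¹ * E).trace * t +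
      ((1 + (Polynomial.X : Polynomial ℝ) • (M⁻¹ * E).map Polynomial.C).det.divX.divX.eval t)
        * t ^ 2) := by
    ext t
    rw [← Matrix.det_one_add_smul, ← Matrix.det_mul, Matrix.mul_add, Matrix.mul_one,
      Matrix.mul_smul, ← Matrix.mul_assoc, Matrix.mul_nonsing_inv _ hM, Matrix.one_mul]
  rw [h]
  set p := (1 + (Polynomial.X : Polynomial ℝ) • (M⁻¹ * E).map Polynomial.C).det.divX.divX
  have h2 := ((((hasDerivAt_id (0 : ℝ)).const_mul (M⁻¹ * E).trace).const_add 1).add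
    ((p.hasDerivAt 0).mul ((hasDerivAt_id (0 : ℝ)).pow 2))).const_mul M.det
  simpa using h2

lemma affineMatrix_add_smul {n : ℕ} (x : CoordIdx n → ℝ) (a : CoordIdx n) (t : ℝ) :
    affineMatrix (x + t • Pi.single a 1)
      = affineMatrix x + t • symOf (Pi.single (Sum.inr a) 1) := by
  rw [affineMatrix_eq_symOf, affineMatrix_eq_symOf, ← map_smul, ← map_add]
  congr 1
  ext b
  rcases b with ⟨⟩ | b
  · simp
  · by_cases hb : b = a
    · subst hb; simp
    · simp [hb, Pi.single_eq_of_ne]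

/-- The product rule for det^(-1/n) · M. The bracket is the part of the coordinate direction
orthogonal to `M` for the metric at `M`. -/
lemma coordField_eq {n : ℕ} [NeZero n] {x : CoordIdx n → ℝ} (hx : (affineMatrix x).PosDef)
    (a : CoordIdx n) :
    coordField a x = ((affineMatrix x).det ^ (-(1 : ℝ) / (n : ℝ))) •
      (symOf (Pi.single (Sum.inr a) 1) -
        ((n : ℝ)⁻¹ * ((affineMatrix x)⁻¹ * symOf (Pi.single (Sum.inr a) 1)).trace) •
          affineMatrix x) := by
  set M := affineMatrix x with hMdef
  set E : Matrix (Fin n) (Fin n) ℝ := symOf (Pi.single (Sum.inr a) 1) with hE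
  ext i j
  have hd : 0 < M.det := hx.det_pos
  have hdet := hasDerivAt_det_line M E hd.ne'.isUnit
  have hpow : HasDerivAt (fun t : ℝ => (M + t • E).det ^ (-(1 : ℝ) / (n : ℝ)))
      (M.det * (M⁻¹ * E).trace * (-(1 : ℝ) / n) * M.det ^ (-(1 : ℝ) / n - 1)) 0 := by
    have := hdet.rpow_const (p := -(1 : ℝ) / n) (Or.inl (by simpa using hd.ne'))
    simpa using this
  have hlin : HasDerivAt (fun t : ℝ => M i j + t * E i j) (E i j) 0 := by
    simpa using ((hasDerivAt_id (0 : ℝ)).mul_const (E i j)).const_add (M i j)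
  have hmul := hpow.mul hlin
  have hfun : (fun t : ℝ => hypParam (x + t • Pi.single a 1) i j)
      = (fun t : ℝ => (M + t • E).det ^ (-(1 : ℝ) / (n : ℝ))) * fun t => M i j + t * E i j := by
    ext t
    simp only [hypParam, affineMatrix_add_smul, Matrix.smul_apply, Matrix.add_apply, smul_eq_mul,
      Pi.mul_apply, ← hMdef, ← hE]
  simp only [coordField, Matrix.of_apply, lineDeriv]
  rw [hfun, hmul.deriv]
  have hpw : M.det * M.det ^ (-(1 : ℝ) / n - 1) = M.det ^ (-(1 : ℝ) / n) := by
    rw [Real.rpow_sub_one hd.ne']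
    field_simp
  simp only [zero_smul, add_zero, zero_mul, Matrix.smul_apply, Matrix.sub_apply, smul_eq_mul]
  rw [show M.det * (M⁻¹ * E).trace * (-(1 : ℝ) / n) * M.det ^ (-(1 : ℝ) / n - 1) * M i j
    = (M.det * M.det ^ (-(1 : ℝ) / n - 1)) * ((M⁻¹ * E).trace * (-(1 : ℝ) / n) * M i j) by ring,
    hpw]
  ring

lemma metricTensor_smul {n : ℕ} {c : ℝ} (hc : c ≠ 0) {M : Matrix (Fin n) (Fin n) ℝ}
    (hM : IsUnit M.det) (A B : Matrix (Fin n) (Fin n) ℝ) :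
    metricTensor (c • M) (c • A) (c • B) = metricTensor M A B := by
  have : (c • M)⁻¹ = c⁻¹ • M⁻¹ := Matrix.inv_smul' M (Units.mk0 c hc) hM
  simp [metricTensor, this, smul_smul, hc]

/-- The common scale cancels from the metric. Removing the `M`-components subtracts the product of
the pairings with `M`, divided by ⟨M, M⟩ = n; this is the shape of a Schur complement. -/
lemma gramMatrix_apply {n : ℕ} [NeZero n] {x : CoordIdx n → ℝ} (hx : (affineMatrix x).PosDef)
    (a b : CoordIdx n) :
    gramMatrix x a b = metricTensor (affineMatrix x) (symOf (Pi.single (Sum.inr a) 1))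
        (symOf (Pi.single (Sum.inr b) 1)) -
      (n : ℝ)⁻¹ * ((affineMatrix x)⁻¹ * symOf (Pi.single (Sum.inr a) 1)).trace *
        ((affineMatrix x)⁻¹ * symOf (Pi.single (Sum.inr b) 1)).trace := by
  have hd : 0 < (affineMatrix x).det := hx.det_pos
  simp only [gramMatrix, Matrix.of_apply]
  rw [coordField_eq hx, coordField_eq hx, hypParam,
    metricTensor_smul (Real.rpow_pos_of_pos hd _).ne' hd.ne'.isUnit]
  set M := affineMatrix x
  have h1 : M⁻¹ * M = 1 := Matrix.nonsing_inv_mul _ hd.ne'.isUnit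
  have hn : (n : ℝ) ≠ 0 := Nat.cast_ne_zero.2 (NeZero.ne n)
  generalize symOf (Pi.single (Sum.inr a) 1) = A
  generalize symOf (Pi.single (Sum.inr b) 1) = B
  simp only [metricTensor, mul_sub, sub_mul, Matrix.mul_smul, Matrix.smul_mul, h1,
    Matrix.trace_sub, Matrix.trace_smul, smul_eq_mul, Matrix.one_mul, Matrix.trace_one,
    Fintype.card_fin]
  rw [Matrix.mul_assoc (M⁻¹ * A) M⁻¹ M, h1, Matrix.mul_one]
  field_simp
  ring

lemma sum_smul_single {ι : Type*} [Fintype ι] [DecidableEq ι] (v : ι → ℝ) :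
    ∑ a, v a • (Pi.single a (1 : ℝ) : ι → ℝ) = v := by
  ext b
  simp [Finset.sum_apply, Pi.single_apply]

/-- Replacing the basis vector of the (0,0) entry by `M` itself is unipotent, since that entry of
`M` is 1. In the new basis the full Gram matrix has corner ⟨M, M⟩ = n, with Schur complement
`gramMatrix x`. -/
lemma det_gramMatrix {n : ℕ} [NeZero n] {x : CoordIdx n → ℝ} (hx : (affineMatrix x).PosDef) :
    (n : ℝ) * (gramMatrix x).det = (fullGram (affineMatrix x)).det := by
  have hd : 0 < (affineMatrix x).det := hx.det_pos
  have hn : (n : ℝ) ≠ 0 := Nat.cast_ne_zero.2 (NeZero.ne n)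
  set M := affineMatrix x with hM
  have h1 : M⁻¹ * M = 1 := Matrix.nonsing_inv_mul _ hd.ne'.isUnit
  set T : Matrix (FullIdx n) (FullIdx n) ℝ := Matrix.fromBlocks 1 0 (Matrix.of fun a _ => x a) 1
    with hT
  have hTdet : T.det = 1 := by simp [hT]
  have hTl : Matrix.toLin' T (Pi.single (Sum.inl ()) 1) = Sum.elim (fun _ => 1) x := by
    ext b
    rcases b with ⟨⟩ | b <;> simp [hT]
  have hTr : ∀ a, Matrix.toLin' T (Pi.single (Sum.inr a) 1) = Pi.single (Sum.inr a) 1 := by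
    intro a
    ext b
    rcases b with ⟨⟩ | b
    · simp [hT]
    · simp [hT, Matrix.one_apply, Pi.single_apply]
  have hcomp : Tᵀ * fullGram M * T
      = LinearMap.BilinForm.toMatrix' ((metricForm M).comp (Matrix.toLin' T)
          (Matrix.toLin' T)) := by
    rw [LinearMap.BilinForm.toMatrix'_comp, fullGram_eq, LinearMap.toMatrix'_toLin']
  set w : CoordIdx n → ℝ := fun a => (M⁻¹ * symOf (Pi.single (Sum.inr a) 1)).trace
  have hblock : Tᵀ * fullGram M * T = Matrix.fromBlocks
      (Matrix.diagonal fun _ : Unit => (n : ℝ)) (Matrix.of fun _ a => w a)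
      (Matrix.of fun a _ => w a)
      (Matrix.of fun a b => metricTensor M (symOf (Pi.single (Sum.inr a) 1))
        (symOf (Pi.single (Sum.inr b) 1))) := by
    rw [hcomp]
    ext a b
    rw [LinearMap.BilinForm.toMatrix'_apply, LinearMap.BilinForm.comp_apply, metricForm_apply]
    rcases a with ⟨⟩ | a <;> rcases b with ⟨⟩ | b
    · rw [hTl, ← affineMatrix_eq_symOf, ← hM]
      simp [metricTensor, h1]
    · rw [hTl, hTr, ← affineMatrix_eq_symOf, ← hM]
      simp [metricTensor, h1, w]
    · rw [hTl, hTr, ← affineMatrix_eq_symOf, ← hM]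
      simp [metricTensor, h1, w, Matrix.mul_assoc]
    · rw [hTr, hTr]
      simp
  have hdet : (Tᵀ * fullGram M * T).det = (fullGram M).det := by
    rw [Matrix.det_mul, Matrix.det_mul, Matrix.det_transpose, hTdet]
    ring
  rw [← hdet, hblock]
  let _ : Invertible (fun _ : Unit => (n : ℝ)) :=
    ⟨fun _ => (n : ℝ)⁻¹, by ext; simp [hn], by ext; simp [hn]⟩
  let _ : Invertible (Matrix.diagonal fun _ : Unit => (n : ℝ)) := Matrix.diagonalInvertible _
  rw [Matrix.det_fromBlocks₁₁, Matrix.det_diagonal]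
  simp only [Finset.univ_unique, Finset.prod_const, Finset.card_singleton, pow_one]
  congr 2
  ext a b
  rw [gramMatrix_apply hx, Matrix.sub_apply, Matrix.invOf_eq_nonsing_inv]
  simp [Matrix.mul_apply, w, ← hM]
  left
  ring

lemma sqrt_det_gramMatrix {n : ℕ} [NeZero n] : ∃ c : ℝ, 0 < c ∧ ∀ x : CoordIdx n → ℝ,
    (affineMatrix x).PosDef → Real.sqrt (gramMatrix x).det
      = c * (affineMatrix x).det ^ (-((n : ℝ) + 1) / 2) := by
  have hn : (0 : ℝ) < n := Nat.cast_pos.2 (NeZero.pos n)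
  have hpos := det_fullGram_one_pos (n := n)
  refine ⟨Real.sqrt ((fullGram (1 : Matrix (Fin n) (Fin n) ℝ)).det / n), by positivity,
    fun x hx => ?_⟩
  have hd : 0 < (affineMatrix x).det := hx.det_pos
  have h1 := det_gramMatrix hx
  have h2 := det_fullGram hx
  have h3 : (gramMatrix x).det = (fullGram (1 : Matrix (Fin n) (Fin n) ℝ)).det / n *
      ((affineMatrix x).det ^ (-((n : ℝ) + 1) / 2)) ^ 2 := by
    rw [← Real.rpow_natCast, ← Real.rpow_mul hd.le]
    have : -((n : ℝ) + 1) / 2 * (2 : ℕ) = -((n + 1 : ℕ) : ℝ) := by push_cast; ring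
    rw [this, Real.rpow_neg hd.le, Real.rpow_natCast, ← h2, ← h1]
    field_simp
  rw [h3, Real.sqrt_mul (by positivity), Real.sqrt_sq (by positivity)]

/-! ### The positive cone and its invariant measure -/

lemma continuous_symOf {n : ℕ} : Continuous (symOf : (FullIdx n → ℝ) → Matrix (Fin n) (Fin n) ℝ) :=
  continuous_matrix fun i j => continuous_apply (entryIdx i j)

lemma isHermitian_symOf {n : ℕ} (v : FullIdx n → ℝ) : (symOf v).IsHermitian := by
  rw [Matrix.IsHermitian, Matrix.conjTranspose_eq_transpose_of_trivial]
  exact isSymm_symOf v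

/-- The coordinates of the positive definite matrices. -/
def posCone (n : ℕ) : Set (FullIdx n → ℝ) := {v | (symOf v).PosDef}

lemma mem_posCone_iff {n : ℕ} {v : FullIdx n → ℝ} : v ∈ posCone n ↔ (symOf v).PosDef := Iff.rfl

/-- Testing on the unit sphere suffices by homogeneity; its compactness is what makes the cone open.
-/
lemma mem_posCone_iff_forall {n : ℕ} {v : FullIdx n → ℝ} :
    v ∈ posCone n ↔ ∀ x ∈ Metric.sphere (0 : Fin n → ℝ) 1, 0 < x ⬝ᵥ (symOf v *ᵥ x) := by
  rw [mem_posCone_iff, Matrix.posDef_iff_dotProduct_mulVec]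
  constructor
  · rintro ⟨-, h⟩ x hx
    exact h (by rintro rfl; simp at hx)
  · refine fun h => ⟨isHermitian_symOf v, fun {x} hx => ?_⟩
    have hx' : 0 < ‖x‖ := norm_pos_iff.2 hx
    have := h (‖x‖⁻¹ • x) (by simp [norm_smul, hx'.ne'])
    rw [Matrix.mulVec_smul, dotProduct_smul, smul_dotProduct, smul_smul, smul_eq_mul] at this
    exact pos_of_mul_pos_right this (by positivity)

lemma isOpen_posCone (n : ℕ) : IsOpen (posCone n) := by
  rw [isOpen_iff_mem_nhds]
  intro v hv
  have h := (isCompact_sphere (0 : Fin n → ℝ) 1).eventually_forall_of_forall_eventually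
    (x₀ := v) (P := fun w x => 0 < x ⬝ᵥ (symOf w *ᵥ x)) (fun x hx => by
      have hc : Continuous fun z : (FullIdx n → ℝ) × (Fin n → ℝ) =>
          z.2 ⬝ᵥ (symOf z.1 *ᵥ z.2) :=
        continuous_snd.dotProduct ((continuous_symOf.comp continuous_fst).matrix_mulVec
          continuous_snd)
      exact hc.continuousAt.eventually (lt_mem_nhds (mem_posCone_iff_forall.1 hv x hx)))
  filter_upwards [h] with w hw
  exact mem_posCone_iff_forall.2 hw

lemma isClosed_setOf_posSemidef (n : ℕ) :
    IsClosed {v : FullIdx n → ℝ | (symOf v).PosSemidef} := by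
  have : {v : FullIdx n → ℝ | (symOf v).PosSemidef}
      = ⋂ x : Fin n → ℝ, {v | 0 ≤ x ⬝ᵥ (symOf v *ᵥ x)} := by
    ext v
    simp only [mem_ofPred_eq, mem_iInter, Matrix.posSemidef_iff_dotProduct_mulVec,
      isHermitian_symOf, true_and, star_trivial]
  rw [this]
  exact isClosed_iInter fun x => isClosed_le continuous_const
    (continuous_const.dotProduct (continuous_symOf.matrix_mulVec continuous_const))

lemma smul_mem_posCone {n : ℕ} {c : ℝ} (hc : 0 < c) {v : FullIdx n → ℝ} (hv : v ∈ posCone n) :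
    c • v ∈ posCone n := by
  rw [mem_posCone_iff, map_smul]
  exact Matrix.PosDef.smul hv hc

lemma smul_mem_posCone_iff {n : ℕ} {c : ℝ} (hc : 0 < c) {v : FullIdx n → ℝ} :
    c • v ∈ posCone n ↔ v ∈ posCone n := by
  refine ⟨fun h => ?_, smul_mem_posCone hc⟩
  simpa [smul_smul, hc.ne'] using smul_mem_posCone (inv_pos.2 hc) h

/-- The density `det ^ (-(n+1)/2)` of the `GL_n`-invariant measure on the positive cone. -/
def invDensity {n : ℕ} (M : Matrix (Fin n) (Fin n) ℝ) : ENNReal :=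
  ENNReal.ofReal (M.det ^ (-((n : ℝ) + 1) / 2))

lemma measurable_invDensity_symOf {n : ℕ} :
    Measurable fun v : FullIdx n → ℝ => invDensity (symOf v) :=
  ((continuous_symOf.matrix_det).measurable.pow_const _).ennreal_ofReal

/-- The `GL_n`-invariant measure on the cone of positive definite matrices. -/
def invMeasure (n : ℕ) : Measure (FullIdx n → ℝ) :=
  (volume.restrict (posCone n)).withDensity fun v => invDensity (symOf v)

lemma invMeasure_apply {n : ℕ} {A : Set (FullIdx n → ℝ)} (hA : MeasurableSet A) :
    invMeasure n A = ∫⁻ v in A ∩ posCone n, invDensity (symOf v) := by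
  rw [invMeasure, withDensity_apply _ hA, Measure.restrict_restrict hA]

lemma congrAction_mem_posCone {n : ℕ} [NeZero n] {g : Matrix (Fin n) (Fin n) ℝ} (hg : g.det ≠ 0)
    {v : FullIdx n → ℝ} (hv : v ∈ posCone n) : congrAction g v ∈ posCone n := by
  rw [mem_posCone_iff, symOf_congrAction, ← Matrix.conjTranspose_eq_transpose_of_trivial]
  exact Matrix.PosDef.mul_mul_conjTranspose_same hv
    (Matrix.vecMul_injective_iff_isUnit.2 ((Matrix.isUnit_iff_isUnit_det g).2 hg.isUnit))

lemma congrAction_inv_apply {n : ℕ} [NeZero n] {g : Matrix (Fin n) (Fin n) ℝ} (hg : g.det ≠ 0)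
    (v : FullIdx n → ℝ) : congrAction g⁻¹ (congrAction g v) = v := by
  rw [← LinearMap.comp_apply, ← congrAction_mul, Matrix.nonsing_inv_mul _ hg.isUnit,
    congrAction_one, LinearMap.id_apply]

lemma congrAction_apply_inv {n : ℕ} [NeZero n] {g : Matrix (Fin n) (Fin n) ℝ} (hg : g.det ≠ 0)
    (v : FullIdx n → ℝ) : congrAction g (congrAction g⁻¹ v) = v := by
  rw [← LinearMap.comp_apply, ← congrAction_mul, Matrix.mul_nonsing_inv _ hg.isUnit,
    congrAction_one, LinearMap.id_apply]

lemma congrAction_mem_posCone_iff {n : ℕ} [NeZero n] {g : Matrix (Fin n) (Fin n) ℝ}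
    (hg : g.det ≠ 0) {v : FullIdx n → ℝ} : congrAction g v ∈ posCone n ↔ v ∈ posCone n := by
  refine ⟨fun h => ?_, congrAction_mem_posCone hg⟩
  have hg' : (g⁻¹).det ≠ 0 := by
    rw [Matrix.det_nonsing_inv, Ring.inverse_eq_inv']
    exact inv_ne_zero hg
  simpa [congrAction_inv_apply hg] using congrAction_mem_posCone hg' h

lemma continuous_congrAction {n : ℕ} [NeZero n] (g : Matrix (Fin n) (Fin n) ℝ) :
    Continuous (congrAction g) := LinearMap.continuous_of_finiteDimensional _

/-- The exponent -(n+1)/2 is the one for which (det g)² cancels the Jacobian |det g|^(n+1). -/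
lemma invDensity_congr {n : ℕ} {g : Matrix (Fin n) (Fin n) ℝ} (hg : g.det ≠ 0)
    {M : Matrix (Fin n) (Fin n) ℝ} (hM : M.PosDef) :
    ENNReal.ofReal (|g.det| ^ (n + 1)) * invDensity (g * M * gᵀ) = invDensity M := by
  have hd := hM.det_pos
  have hg' : 0 < |g.det| := abs_pos.2 hg
  rw [invDensity, invDensity, ← ENNReal.ofReal_mul (by positivity)]
  congr 1
  rw [Matrix.det_mul, Matrix.det_mul, Matrix.det_transpose,
    show g.det * M.det * g.det = |g.det| ^ (2 : ℝ) * M.det by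
      rw [Real.rpow_two, sq_abs]; ring,
    Real.mul_rpow (by positivity) hd.le, ← Real.rpow_mul hg'.le, ← mul_assoc,
    ← Real.rpow_natCast, ← Real.rpow_add hg']
  have : ((n + 1 : ℕ) : ℝ) + 2 * (-((n : ℝ) + 1) / 2) = 0 := by push_cast; ring
  rw [this, Real.rpow_zero, one_mul]

lemma invMeasure_preimage_congrAction {n : ℕ} [NeZero n] {g : Matrix (Fin n) (Fin n) ℝ}
    (hg : g.det ≠ 0) {A : Set (FullIdx n → ℝ)} (hA : MeasurableSet A) :
    invMeasure n (congrAction g ⁻¹' A) = invMeasure n A := by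
  have hpre : MeasurableSet (congrAction g ⁻¹' A) := (continuous_congrAction g).measurable hA
  have hinj : Function.Injective (congrAction g) :=
    Function.LeftInverse.injective (congrAction_inv_apply hg)
  have himg : congrAction g '' (congrAction g ⁻¹' A ∩ posCone n) = A ∩ posCone n := by
    ext v
    constructor
    · rintro ⟨w, ⟨hw, hw'⟩, rfl⟩
      exact ⟨hw, congrAction_mem_posCone hg hw'⟩
    · rintro ⟨hv, hv'⟩
      refine ⟨congrAction g⁻¹ v, ⟨?_, ?_⟩, congrAction_apply_inv hg v⟩
      · rwa [mem_preimage, congrAction_apply_inv hg]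
      · rwa [← congrAction_mem_posCone_iff hg, congrAction_apply_inv hg]
  have hm : MeasurableSet (congrAction g ⁻¹' A ∩ posCone n) :=
    hpre.inter (isOpen_posCone n).measurableSet
  rw [invMeasure_apply hA, invMeasure_apply hpre, ← himg,
    lintegral_image_eq_lintegral_abs_det_fderiv_mul volume hm
      (f := congrAction g) (f' := fun _ => LinearMap.toContinuousLinearMap (congrAction g))
      (fun v _ => (LinearMap.toContinuousLinearMap (congrAction g)).hasFDerivWithinAt)
      hinj.injOn]
  refine setLIntegral_congr_fun hm fun v hv => ?_
  have hdet : ContinuousLinearMap.det (LinearMap.toContinuousLinearMap (congrAction g))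
      = LinearMap.det (congrAction g) := by
    rw [ContinuousLinearMap.det, LinearMap.coe_toContinuousLinearMap]
  rw [hdet, abs_det_congrAction hg, symOf_congrAction]
  exact (invDensity_congr hg hv.2).symm

lemma invMeasure_preimage_smul {n : ℕ} [NeZero n] {c : ℝ} (hc : 0 < c)
    {A : Set (FullIdx n → ℝ)} (hA : MeasurableSet A) :
    invMeasure n ((fun v => c • v) ⁻¹' A) = invMeasure n A := by
  have h : (congrAction (Real.sqrt c • (1 : Matrix (Fin n) (Fin n) ℝ)) : (FullIdx n → ℝ) → _)
      = fun v => c • v := by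
    ext1 v
    apply symOf_injective
    simp [symOf_congrAction, smul_smul, Real.mul_self_sqrt hc.le]
  rw [← h]
  refine invMeasure_preimage_congrAction ?_ hA
  rw [Matrix.det_smul, Matrix.det_one, mul_one]
  exact pow_ne_zero _ (Real.sqrt_pos.2 hc).ne'

/-! ### Slices and slabs of a cone -/

/-- Cut the φ-slab into dyadic pieces according to ψ. Scaling by 2⁻ᵏ carries the k-th piece into the
ψ-slab without changing its measure, and the images are disjoint because 2ᵏ φ lies in [1, 2) for at
most one k. -/
lemma invMeasure_slice_le {n : ℕ} [NeZero n] {K : Set (FullIdx n → ℝ)} (hK : MeasurableSet K)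
    (hcone : ∀ c : ℝ, 0 < c → ∀ v, c • v ∈ K ↔ v ∈ K) {φ ψ : (FullIdx n → ℝ) → ℝ}
    (hφ : Measurable φ) (hψ : Measurable ψ)
    (hφc : ∀ c : ℝ, 0 < c → ∀ v, φ (c • v) = c * φ v)
    (hψc : ∀ c : ℝ, 0 < c → ∀ v, ψ (c • v) = c * ψ v)
    (hψpos : ∀ v ∈ K, 0 < ψ v) :
    invMeasure n (K ∩ φ ⁻¹' Ico 1 2) ≤ invMeasure n (K ∩ ψ ⁻¹' Ico 1 2) := by
  set B : ℤ → Set (FullIdx n → ℝ) :=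
    fun k => K ∩ φ ⁻¹' Ico 1 2 ∩ (fun v => ((2 : ℝ) ^ k)⁻¹ * ψ v) ⁻¹' Ico 1 2
  set B' : ℤ → Set (FullIdx n → ℝ) :=
    fun k => K ∩ (fun v => (2 : ℝ) ^ k * φ v) ⁻¹' Ico 1 2 ∩ ψ ⁻¹' Ico 1 2
  have hB : ∀ k, MeasurableSet (B k) := fun k =>
    (hK.inter (hφ measurableSet_Ico)).inter ((hψ.const_mul _) measurableSet_Ico)
  have hB' : ∀ k, MeasurableSet (B' k) := fun k =>
    (hK.inter ((hφ.const_mul _) measurableSet_Ico)).inter (hψ measurableSet_Ico)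
  have hBB' : ∀ k, invMeasure n (B k) = invMeasure n (B' k) := by
    intro k
    have h2 : (0 : ℝ) < 2 ^ k := by positivity
    rw [← invMeasure_preimage_smul h2 (hB k)]
    congr 1
    ext v
    simp only [B, B', mem_preimage, mem_inter_iff, hcone _ h2, hφc _ h2, hψc _ h2]
    rw [inv_mul_cancel_left₀ h2.ne']
  have hcover : K ∩ φ ⁻¹' Ico 1 2 ⊆ ⋃ k, B k := by
    intro v hv
    obtain ⟨k, hk1, hk2⟩ := exists_mem_Ico_zpow (hψpos v hv.1) one_lt_two
    refine mem_iUnion.2 ⟨k, hv, ?_⟩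
    have h2 : (0 : ℝ) < 2 ^ k := by positivity
    rw [zpow_add_one₀ two_ne_zero] at hk2
    rw [mem_preimage, mem_Ico, ← div_eq_inv_mul, le_div_iff₀ h2, div_lt_iff₀ h2]
    constructor <;> linarith
  have hdisj : Pairwise (Function.onFun Disjoint B') := by
    have hlt : ∀ k l : ℤ, k < l → Disjoint (B' k) (B' l) := by
      intro k l hkl
      rw [Set.disjoint_left]
      rintro v ⟨⟨-, hk⟩, -⟩ ⟨⟨-, hl⟩, -⟩
      simp only [mem_preimage, mem_Ico] at hk hl
      have hkp : (0 : ℝ) < 2 ^ k := by positivity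
      have hpos : 0 < φ v := by
        by_contra! hneg
        nlinarith [hk.1]
      have h1 : (2 : ℝ) ^ (k + 1) ≤ 2 ^ l := zpow_le_zpow_right₀ one_le_two hkl
      rw [zpow_add_one₀ two_ne_zero] at h1
      have := mul_le_mul_of_nonneg_right h1 hpos.le
      nlinarith [hk.1, hl.2]
    intro k l hkl
    rcases lt_or_gt_of_ne hkl with h | h
    · exact hlt k l h
    · exact (hlt l k h).symm
  calc invMeasure n (K ∩ φ ⁻¹' Ico 1 2) ≤ invMeasure n (⋃ k, B k) := measure_mono hcover
    _ ≤ ∑' k, invMeasure n (B k) := measure_iUnion_le _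
    _ = ∑' k, invMeasure n (B' k) := by simp only [hBB']
    _ = invMeasure n (⋃ k, B' k) := (measure_iUnion hdisj hB').symm
    _ ≤ invMeasure n (K ∩ ψ ⁻¹' Ico 1 2) :=
      measure_mono (iUnion_subset fun k v hv => ⟨hv.1.1, hv.2⟩)

lemma invDensity_smul {n : ℕ} [NeZero n] {c : ℝ} (hc : 0 < c) {M : Matrix (Fin n) (Fin n) ℝ}
    (hM : M.PosDef) : invDensity (c • M)
      = ENNReal.ofReal ((c ^ Fintype.card (FullIdx n))⁻¹) * invDensity M := by
  have hd := hM.det_pos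
  rw [invDensity, invDensity, ← ENNReal.ofReal_mul (by positivity), Matrix.det_smul,
    Real.mul_rpow (by positivity) hd.le, Fintype.card_fin, ← Real.rpow_natCast c n,
    ← Real.rpow_mul hc.le, ← Real.rpow_natCast, ← Real.rpow_neg hc.le]
  have h := card_fullIdx (n := n)
  have h' : 2 * (Fintype.card (FullIdx n) : ℝ) = n * (n + 1) := by exact_mod_cast h
  congr 3
  linarith

/-- The integral of the invariant density over the slice `x_00 = 1` of a cone is finite if and
only if the invariant measure of its part `1 ≤ x_00 < 2` is. -/
lemma lintegral_slice_lt_top_iff {n : ℕ} [NeZero n] {K : Set (FullIdx n → ℝ)}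
    (hK : MeasurableSet K) (hcone : ∀ c : ℝ, 0 < c → ∀ v, c • v ∈ K ↔ v ∈ K) :
    (∫⁻ x in {x : CoordIdx n → ℝ | Sum.elim (fun _ => 1) x ∈ K ∩ posCone n},
      invDensity (affineMatrix x)) < ⊤ ↔
    invMeasure n (K ∩ (fun v => v (Sum.inl ())) ⁻¹' Ico 1 2) < ⊤ := by
  set F : (FullIdx n → ℝ) → ENNReal := (K ∩ posCone n).indicator fun v => invDensity (symOf v)
    with hF
  have hFm : Measurable F := measurable_invDensity_symOf.indicator
    (hK.inter (isOpen_posCone n).measurableSet)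
  have hFhom : ∀ c : ℝ, 0 < c → ∀ v, F (c • v)
      = ENNReal.ofReal ((c ^ Fintype.card (FullIdx n))⁻¹) * F v := by
    intro c hc v
    by_cases hv : v ∈ K ∩ posCone n
    · have hv' : c • v ∈ K ∩ posCone n := ⟨(hcone c hc v).2 hv.1, smul_mem_posCone hc hv.2⟩
      rw [hF, indicator_of_mem hv, indicator_of_mem hv', map_smul, invDensity_smul hc hv.2]
    · have hv' : c • v ∉ K ∩ posCone n := fun h =>
        hv ⟨(hcone c hc v).1 h.1, (smul_mem_posCone_iff hc).1 h.2⟩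
      rw [hF, indicator_of_notMem hv, indicator_of_notMem hv', mul_zero]
  have hmeas1 : Measurable fun x : CoordIdx n → ℝ =>
      (Sum.elim (fun _ => 1) x : FullIdx n → ℝ) := by
    refine measurable_pi_lambda _ fun a => ?_
    rcases a with ⟨⟩ | a
    · exact measurable_const
    · exact measurable_pi_apply a
  set I := ∫⁻ x : CoordIdx n → ℝ, F (Sum.elim (fun _ => 1) x) with hI
  have hleft : (∫⁻ x in {x : CoordIdx n → ℝ | Sum.elim (fun _ => 1) x ∈ K ∩ posCone n},
      invDensity (affineMatrix x)) = I := by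
    have hms : MeasurableSet
        {x : CoordIdx n → ℝ | (Sum.elim (fun _ => 1) x : FullIdx n → ℝ) ∈ K ∩ posCone n} :=
      hmeas1 (hK.inter (isOpen_posCone n).measurableSet)
    rw [← lintegral_indicator hms]
    congr 1
    ext x
    simp only [hF, indicator, mem_ofPred_eq, affineMatrix_eq_symOf]
  set S : Set (FullIdx n → ℝ) := (fun v => v (Sum.inl ())) ⁻¹' Ico 1 2
  have hS : MeasurableSet S := measurable_pi_apply _ measurableSet_Ico
  have hright : invMeasure n (K ∩ S) = ∫⁻ v, S.indicator F v := by
    rw [invMeasure_apply (hK.inter hS), lintegral_indicator hS, hF,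
      setLIntegral_indicator (hK.inter (isOpen_posCone n).measurableSet)]
    congr 2
    ext v
    simp only [mem_inter_iff]
    tauto
  -- The substitution y = a x contributes a^(N-1), with N the dimension of the cone, and the density
  -- has degree -N.
  have hinner : ∀ a : ℝ, 0 < a → ∫⁻ y : CoordIdx n → ℝ, F (Sum.elim (fun _ => a) y)
      = ENNReal.ofReal a⁻¹ * I := by
    intro a ha
    have hmeasa : Measurable fun x : CoordIdx n → ℝ =>
        F (Sum.elim (fun _ => a) x : FullIdx n → ℝ) := by
      refine hFm.comp (measurable_pi_lambda _ fun b => ?_)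
      rcases b with ⟨⟩ | b
      · exact measurable_const
      · exact measurable_pi_apply b
    have h1 := lintegral_map (μ := (volume : Measure (CoordIdx n → ℝ))) hmeasa
      (measurable_const_smul a)
    rw [Measure.map_addHaar_smul _ ha.ne', lintegral_smul_measure, Module.finrank_fintype_fun_eq_card] at h1
    have h2 : ∀ x : CoordIdx n → ℝ, (Sum.elim (fun _ => a) (a • x) : FullIdx n → ℝ)
        = a • (Sum.elim (fun _ => 1) x : FullIdx n → ℝ) := by
      intro x
      ext b
      rcases b with ⟨⟩ | b <;> simp
    simp only [h2, hFhom a ha] at h1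
    rw [lintegral_const_mul _ (show Measurable fun x : CoordIdx n → ℝ =>
      F (Sum.elim (fun _ => 1) x) from hFm.comp hmeas1), ← hI] at h1
    set d := Fintype.card (CoordIdx n)
    have hN : Fintype.card (FullIdx n) = d + 1 := by
      rw [Fintype.card_sum, Fintype.card_unit, add_comm]
    rw [hN, abs_of_pos (by positivity), smul_eq_mul] at h1
    have h3 := congrArg (fun z => ENNReal.ofReal (a ^ d) * z) h1
    simp only [← mul_assoc] at h3
    rw [← ENNReal.ofReal_mul (by positivity), ← ENNReal.ofReal_mul (by positivity),
      mul_inv_cancel₀ (by positivity), ENNReal.ofReal_one, one_mul] at h3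
    rw [h3, pow_succ, mul_inv, mul_inv_cancel_left₀ (by positivity)]
  have htotal : ∫⁻ v, S.indicator F v = (∫⁻ a in Ico (1 : ℝ) 2, ENNReal.ofReal a⁻¹) * I := by
    have hmp := (volume_measurePreserving_sumPiEquivProdPi_symm (ι := Unit) (ι' := CoordIdx n) (fun _ => ℝ))
    rw [← hmp.lintegral_comp_emb (MeasurableEquiv.measurableEmbedding _)]
    rw [Measure.volume_eq_prod, lintegral_prod _ (by
      exact ((hFm.indicator hS).comp (MeasurableEquiv.measurable _)).aemeasurable)]
    have hmp2 := volume_preserving_funUnique Unit ℝ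
    rw [← hmp2.symm.lintegral_comp_emb (MeasurableEquiv.measurableEmbedding _)]
    rw [← lintegral_mul_const _ (by fun_prop), ← lintegral_indicator measurableSet_Ico]
    congr 1
    ext a
    have hval : ∀ y : CoordIdx n → ℝ,
        (MeasurableEquiv.sumPiEquivProdPi (fun _ : FullIdx n => ℝ)).symm
          ((MeasurableEquiv.funUnique Unit ℝ).symm a, y) = Sum.elim (fun _ => a) y := by
      intro y
      ext b
      rcases b with ⟨⟩ | b <;> rfl
    simp only [hval]
    by_cases ha : a ∈ Ico (1 : ℝ) 2
    · rw [indicator_of_mem ha, ← hinner a (by linarith [ha.1])]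
      congr 1
      ext y
      exact indicator_of_mem (show (Sum.elim (fun _ => a) y : FullIdx n → ℝ) ∈ S from ha) F
    · rw [indicator_of_notMem ha]
      refine (lintegral_congr fun y => ?_).trans lintegral_zero
      exact indicator_of_notMem
        (show ¬ (Sum.elim (fun _ => a) y : FullIdx n → ℝ) ∈ S from ha) F
  -- Only 0 < J < ∞ matters.
  set J := ∫⁻ a in Ico (1 : ℝ) 2, ENNReal.ofReal a⁻¹
  have hvol : volume (Ico (1 : ℝ) 2) = 1 := by rw [Real.volume_Ico]; norm_num
  have hJtop : J < ⊤ := by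
    calc J ≤ ∫⁻ a in Ico (1 : ℝ) 2, 1 := by
          refine setLIntegral_mono measurable_const fun a ha => ?_
          rw [ENNReal.ofReal_le_one]
          exact inv_le_one_of_one_le₀ ha.1
      _ = 1 := by simp [hvol]
      _ < ⊤ := ENNReal.one_lt_top
  have hJ0 : J ≠ 0 := by
    have : ENNReal.ofReal 2⁻¹ ≤ J := by
      calc ENNReal.ofReal 2⁻¹ = ∫⁻ a in Ico (1 : ℝ) 2, ENNReal.ofReal 2⁻¹ := by simp [hvol]
        _ ≤ J := by
          refine setLIntegral_mono (by fun_prop) fun a ha => ?_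
          exact ENNReal.ofReal_le_ofReal (inv_anti₀ (by linarith [ha.1]) ha.2.le)
    intro h0
    rw [h0, nonpos_iff_eq_zero, ENNReal.ofReal_eq_zero] at this
    norm_num at this
  rw [hleft, hright, htotal]
  refine ⟨fun h => ENNReal.mul_lt_top hJtop h, fun h => ?_⟩
  by_contra hI'
  rw [not_lt_top_iff] at hI'
  rw [hI', ENNReal.mul_top hJ0] at h
  exact lt_irrefl _ h

/-! ### Infinite measure near the boundary of the positive cone -/

lemma invMeasure_pos_of_isOpen {n : ℕ} {K : Set (FullIdx n → ℝ)} (hK : IsOpen K)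
    (hne : K.Nonempty) (hpos : K ⊆ posCone n) : 0 < invMeasure n K := by
  rw [invMeasure_apply hK.measurableSet, inter_eq_left.2 hpos,
    setLIntegral_pos_iff measurable_invDensity_symOf]
  have : Function.support (fun v : FullIdx n → ℝ => invDensity (symOf v)) ∩ K = K := by
    refine inter_eq_right.2 fun v hv => ?_
    have hd : 0 < (symOf v).det := (hpos hv).det_pos
    simp only [Function.mem_support, invDensity]
    exact (ENNReal.ofReal_pos.2 (Real.rpow_pos_of_pos hd _)).ne'
  rw [this]
  exact hK.measure_pos _ hne

/-- The invariant measure is infinite near every boundary point of the cone. -/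
lemma invMeasure_eq_top_of_mem_nhds {n : ℕ} [NeZero n] {W : FullIdx n → ℝ}
    (hW : (symOf W).PosSemidef) (hW' : W ∉ posCone n) {U : Set (FullIdx n → ℝ)}
    (hU : U ∈ 𝓝 W) : invMeasure n U = ⊤ := by
  obtain ⟨Q, hQ, hWQ⟩ := exists_orthogonal_diagonal hW.1
  set d := hW.1.eigenvalues with hd
  have hd0 : ∀ i, 0 ≤ d i := hW.eigenvalues_nonneg
  obtain ⟨z, hz⟩ : ∃ z, d z = 0 := by
    by_contra! h
    exact hW' (hW.1.posDef_iff_eigenvalues_pos.2 fun i => (hd0 i).lt_of_ne' (h i))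
  have hQ' : Qᵀ * Q = 1 := mul_eq_one_comm.1 hQ
  -- `g t` scales the kernel directions of `W` by `t`. It is invertible for t > 0, and at t = 0 its
  -- congruence collapses the positive definite `v` below onto `W`.
  set δ : ℝ → Matrix (Fin n) (Fin n) ℝ :=
    fun t => Matrix.diagonal fun i => if d i = 0 then t else 1 with hδ
  set g : ℝ → Matrix (Fin n) (Fin n) ℝ := fun t => Q * δ t with hg
  have hgdet : ∀ t : ℝ, 0 < t → (g t).det ≠ 0 := by
    intro t ht
    rw [hg, Matrix.det_mul, hδ, Matrix.det_diagonal]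
    refine mul_ne_zero (fun h => ?_) (Finset.prod_ne_zero_iff.2 fun i _ => ?_)
    · have := congrArg Matrix.det hQ
      rw [Matrix.det_mul, h, zero_mul, Matrix.det_one] at this
      exact zero_ne_one this
    · split_ifs
      exacts [ht.ne', one_ne_zero]
  set e : Fin n → ℝ := fun i => if d i = 0 then 1 else d i with he
  set v : FullIdx n → ℝ := coords (Matrix.diagonal e)
  have hv : symOf v = Matrix.diagonal e := symOf_coords (by
    rw [Matrix.IsSymm, Matrix.diagonal_transpose])
  have hvpos : v ∈ posCone n := by
    rw [mem_posCone_iff, hv]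
    refine Matrix.PosDef.diagonal fun i => ?_
    simp only [he]
    split_ifs with h
    exacts [one_pos, (hd0 i).lt_of_ne' h]
  have hg0 : congrAction (g 0) v = W := by
    apply symOf_injective
    have hde : Matrix.diagonal d = δ 0 * (Matrix.diagonal e * δ 0) := by
      rw [hδ, Matrix.diagonal_mul_diagonal, Matrix.diagonal_mul_diagonal]
      congr 1
      ext i
      simp only [he]
      split_ifs with h <;> simp [h]
    rw [symOf_congrAction, hv, hWQ, hg, Matrix.transpose_mul, hde]
    simp only [hδ, Matrix.diagonal_transpose, Matrix.mul_assoc]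
  have hcont : Continuous fun p : ℝ × (FullIdx n → ℝ) => congrAction (g p.1) p.2 := by
    have hgc : Continuous g := by
      refine continuous_const.matrix_mul (Continuous.matrix_diagonal (continuous_pi fun i => ?_))
      split_ifs
      exacts [continuous_id, continuous_const]
    have hm : Continuous fun p : ℝ × (FullIdx n → ℝ) => g p.1 * symOf p.2 * (g p.1)ᵀ :=
      ((hgc.comp continuous_fst).matrix_mul (continuous_symOf.comp continuous_snd)).matrix_mul
        (hgc.comp continuous_fst).matrix_transpose
    exact continuous_pi fun a => hm.matrix_elem _ _
  have hnhds : (fun p : ℝ × (FullIdx n → ℝ) => congrAction (g p.1) p.2) ⁻¹' U ∈ 𝓝 ((0 : ℝ), v) :=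
    hcont.continuousAt.preimage_mem_nhds (by rwa [hg0])
  obtain ⟨u, hu, K, hK, huK⟩ := mem_nhds_prod_iff.1 hnhds
  obtain ⟨ε, hε, hεu⟩ := Metric.mem_nhds_iff.1 hu
  -- Pinching the entry at the kernel direction `z` separates the images under `g (t j)`: in the
  -- eigenbasis that entry gets multiplied by t_j², and t_j halves at each step.
  set K₀ : Set (FullIdx n → ℝ) :=
    interior K ∩ posCone n ∩ (fun w => symOf w z z) ⁻¹' Ioo (3 / 4) (5 / 4)
  have hK₀ : IsOpen K₀ := (isOpen_interior.inter (isOpen_posCone n)).inter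
    (isOpen_Ioo.preimage (continuous_symOf.matrix_elem z z))
  have hvK₀ : v ∈ K₀ := by
    refine ⟨⟨mem_interior_iff_mem_nhds.2 hK, hvpos⟩, ?_⟩
    rw [mem_preimage, hv, Matrix.diagonal_apply_eq]
    simp only [he, hz, if_true]
    norm_num
  -- The exponent j + 1 makes already the first term smaller than ε.
  set t : ℕ → ℝ := fun j => ε * (1 / 2) ^ (j + 1) with ht
  have htpos : ∀ j, 0 < t j := fun j => by positivity
  set A : ℕ → Set (FullIdx n → ℝ) := fun j => congrAction (g (t j))⁻¹ ⁻¹' K₀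
  have hginv : ∀ j, ((g (t j))⁻¹).det ≠ 0 := fun j => by
    rw [Matrix.det_nonsing_inv, Ring.inverse_eq_inv']
    exact inv_ne_zero (hgdet _ (htpos j))
  have hA : ∀ j, MeasurableSet (A j) := fun j =>
    (continuous_congrAction _).measurable hK₀.measurableSet
  have hAU : ∀ j, A j ⊆ U := by
    intro j w hw
    have htu : t j ∈ u := by
      apply hεu
      rw [Metric.mem_ball, dist_zero_right, Real.norm_eq_abs, abs_of_pos (htpos j)]
      calc t j < ε * 1 := by
            refine mul_lt_mul_of_pos_left ?_ hε
            exact pow_lt_one₀ (by norm_num) (by norm_num) (Nat.succ_ne_zero j)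
        _ = ε := mul_one ε
    have := huK (show (t j, congrAction (g (t j))⁻¹ w) ∈ u ×ˢ K from
      ⟨htu, interior_subset hw.1.1⟩)
    simpa [congrAction_apply_inv (hgdet _ (htpos j))] using this
  have hentry : ∀ j, ∀ w ∈ A j, symOf (congrAction Qᵀ w) z z
      ∈ Ioo (t j ^ 2 * (3 / 4)) (t j ^ 2 * (5 / 4)) := by
    intro j w hw
    set w' := congrAction (g (t j))⁻¹ w
    have hw' : w = congrAction (g (t j)) w' := (congrAction_apply_inv (hgdet _ (htpos j)) w).symm
    have h1 : congrAction Qᵀ w = congrAction (δ (t j)) w' := by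
      rw [hw', ← LinearMap.comp_apply, ← congrAction_mul, hg, ← Matrix.mul_assoc, hQ',
        Matrix.one_mul]
    have h2 : symOf (congrAction Qᵀ w) z z = t j ^ 2 * symOf w' z z := by
      rw [h1, symOf_congrAction, hδ, Matrix.diagonal_transpose, Matrix.mul_diagonal,
        Matrix.diagonal_mul]
      simp only [hz, if_true]
      ring
    have h3 := hw.2
    have h4 := pow_pos (htpos j) 2
    rw [h2]
    exact ⟨mul_lt_mul_of_pos_left h3.1 h4, mul_lt_mul_of_pos_left h3.2 h4⟩
  have hlt : ∀ j l, j < l → Disjoint (A j) (A l) := by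
    intro j l hjl
    rw [Set.disjoint_left]
    intro w hj hl
    have h1 := (hentry j w hj).1
    have h2 := (hentry l w hl).2
    have h3 : t l ≤ t j * (1 / 2) := by
      have : ((1 : ℝ) / 2) ^ (l + 1) ≤ (1 / 2) ^ (j + 1 + 1) :=
        pow_le_pow_of_le_one (by norm_num) (by norm_num) (by omega)
      simp only [ht]
      rw [mul_assoc, ← pow_succ]
      exact mul_le_mul_of_nonneg_left this hε.le
    nlinarith [htpos j, htpos l]
  have hdisj : Pairwise (Function.onFun Disjoint A) := by
    intro j l hjl
    rcases lt_or_gt_of_ne hjl with h | h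
    · exact hlt j l h
    · exact (hlt l j h).symm
  have hpos : invMeasure n K₀ ≠ 0 :=
    (invMeasure_pos_of_isOpen hK₀ ⟨v, hvK₀⟩ fun w hw => hw.1.2).ne'
  rw [← top_le_iff]
  calc ⊤ = ∑' _ : ℕ, invMeasure n K₀ := (ENNReal.tsum_const_eq_top_of_ne_zero hpos).symm
    _ = ∑' j, invMeasure n (A j) := by
        congr 1
        ext j
        exact (invMeasure_preimage_congrAction (hginv j) hK₀.measurableSet).symm
    _ = invMeasure n (⋃ j, A j) := (measure_iUnion hdisj hA).symm
    _ ≤ invMeasure n U := measure_mono (iUnion_subset hAU)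

/-! ### Determinants of weighted sums of rank-one matrices -/

lemma one_le_det_one_add {n : ℕ} {S : Matrix (Fin n) (Fin n) ℝ} (hS : S.PosSemidef) :
    1 ≤ (1 + S).det := by
  obtain ⟨Q, hQ, hSQ⟩ := exists_orthogonal_diagonal hS.1
  have h : 1 + S = Q * Matrix.diagonal (fun i => 1 + hS.1.eigenvalues i) * Qᵀ := by
    rw [← Matrix.diagonal_add, Matrix.mul_add, Matrix.add_mul, ← hSQ, Matrix.diagonal_one,
      Matrix.mul_one, hQ]
  have hQ2 : Q.det * Q.det = 1 := by
    have h := congrArg Matrix.det hQ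
    rwa [Matrix.det_mul, Matrix.det_transpose, Matrix.det_one] at h
  rw [h, Matrix.det_mul, Matrix.det_mul, Matrix.det_transpose, mul_right_comm, hQ2, one_mul,
    Matrix.det_diagonal]
  exact Finset.one_le_prod fun i _ => le_add_of_nonneg_right (hS.eigenvalues_nonneg i)

/-- The determinant is monotone for the Loewner order. -/
lemma det_le_det_of_posSemidef_sub {n : ℕ} {G M : Matrix (Fin n) (Fin n) ℝ} (hG : G.PosSemidef)
    (h : (M - G).PosSemidef) : G.det ≤ M.det := by
  by_cases hd : G.det = 0
  · rw [hd]
    have : M = (M - G) + G := by abel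
    rw [this]
    exact (h.add hG).det_nonneg
  obtain ⟨Q, hQ, hGQ⟩ := exists_orthogonal_diagonal hG.1
  set l := hG.1.eigenvalues
  have hl : ∀ i, 0 ≤ l i := hG.eigenvalues_nonneg
  set g := Q * Matrix.diagonal fun i => Real.sqrt (l i)
  have hgG : g * gᵀ = G := by
    rw [Matrix.transpose_mul, Matrix.diagonal_transpose, Matrix.mul_assoc Q,
      ← Matrix.mul_assoc (Matrix.diagonal _), Matrix.diagonal_mul_diagonal, ← Matrix.mul_assoc]
    simp only [Real.mul_self_sqrt (hl _)]
    exact hGQ.symm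
  have hg : IsUnit g.det := by
    rw [isUnit_iff_ne_zero]
    intro h0
    rw [← hgG, Matrix.det_mul, h0, zero_mul] at hd
    exact hd rfl
  -- For invertible G = g gᵀ, congruence by g⁻¹ reduces the claim to det(1 + S) ≥ 1 with S
  -- semidefinite.
  have hS : (g⁻¹ * (M - G) * (g⁻¹)ᵀ).PosSemidef := by
    rw [← Matrix.conjTranspose_eq_transpose_of_trivial]
    exact h.mul_mul_conjTranspose_same _
  have hM : M = g * (1 + g⁻¹ * (M - G) * (g⁻¹)ᵀ) * gᵀ := by
    have h1 : g * g⁻¹ = 1 := Matrix.mul_nonsing_inv _ hg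
    have h2 : (g⁻¹)ᵀ * gᵀ = 1 := by rw [← Matrix.transpose_mul, h1, Matrix.transpose_one]
    calc M = G + (M - G) := by abel
      _ = g * gᵀ + (g * g⁻¹) * (M - G) * ((g⁻¹)ᵀ * gᵀ) := by
          rw [hgG, h1, h2, Matrix.one_mul, Matrix.mul_one]
      _ = _ := by simp only [Matrix.mul_add, Matrix.add_mul, Matrix.mul_one, Matrix.mul_assoc]
  have hGd : G.det = g.det * g.det := by
    rw [← hgG, Matrix.det_mul, Matrix.det_transpose]
  rw [hM, Matrix.det_mul, Matrix.det_mul, Matrix.det_transpose, mul_right_comm, ← hGd]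
  exact le_mul_of_one_le_right hG.det_nonneg (one_le_det_one_add hS)

lemma posSemidef_smul_vecMulVec {n : ℕ} {s : ℝ} (hs : 0 ≤ s) (x : Fin n → ℝ) :
    (s • Matrix.vecMulVec x x).PosSemidef :=
  (Matrix.posSemidef_vecMulVec_self_star x).smul hs

lemma det_sum_smul_vecMulVec {n : ℕ} (s : Fin n → ℝ) (x : Fin n → Fin n → ℝ) :
    (∑ k, s k • Matrix.vecMulVec (x k) (x k)).det = (∏ k, s k) * (Matrix.of x).det ^ 2 := by
  have h : ∑ k, s k • Matrix.vecMulVec (x k) (x k)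
      = (Matrix.of x)ᵀ * Matrix.diagonal s * Matrix.of x := by
    ext i j
    rw [Matrix.sum_apply, Matrix.mul_apply]
    refine Finset.sum_congr rfl fun k _ => ?_
    simp only [Matrix.smul_apply, Matrix.vecMulVec_apply, smul_eq_mul, Matrix.mul_diagonal,
      Matrix.transpose_apply, Matrix.of_apply]
    ring
  rw [h, Matrix.det_mul, Matrix.det_mul, Matrix.det_transpose, Matrix.det_diagonal]
  ring

/-- Dropping the summands outside the range of `b` lowers the matrix in the Loewner order, hence its
determinant. -/
lemma prod_mul_det_sq_le_det_sum {n : ℕ} {J : Type*} [Fintype J] {s : J → ℝ} (hs : ∀ j, 0 ≤ s j)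
    (x : J → Fin n → ℝ) {b : Fin n → J} (hb : Function.Injective b) :
    (∏ k, s (b k)) * (Matrix.of fun k => x (b k)).det ^ 2
      ≤ (∑ j, s j • Matrix.vecMulVec (x j) (x j)).det := by
  classical
  rw [← det_sum_smul_vecMulVec]
  refine det_le_det_of_posSemidef_sub
    (Matrix.posSemidef_sum _ fun k _ => posSemidef_smul_vecMulVec (hs _) _) ?_
  have h : ∑ j, s j • Matrix.vecMulVec (x j) (x j)
      - ∑ k, s (b k) • Matrix.vecMulVec (x (b k)) (x (b k))
      = ∑ j ∈ Finset.univ \ Finset.univ.image b, s j • Matrix.vecMulVec (x j) (x j) := by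
    rw [← Finset.sum_sdiff (Finset.subset_univ (Finset.univ.image b)),
      Finset.sum_image fun k _ l _ h => hb h]
    abel
  rw [h]
  exact Matrix.posSemidef_sum _ fun j _ => posSemidef_smul_vecMulVec (hs _) _

/-- A spanning family contains a basis of maximal weight, and every vector of the family
is a combination of basis vectors of at least its own weight. -/
lemma exists_basis_of_max_weight {n : ℕ} {J : Type*} [Fintype J] {x : J → Fin n → ℝ}
    (hx : Submodule.span ℝ (range x) = ⊤) {s : J → ℝ} (hs : ∀ j, 0 < s j) :
    ∃ b : Fin n → J, LinearIndependent ℝ (fun k => x (b k)) ∧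
      ∀ j, x j ∈ Submodule.span ℝ ((fun k => x (b k)) '' {k | s j ≤ s (b k)}) := by
  classical
  set T : Finset (Fin n → J) := Finset.univ.filter fun b => LinearIndependent ℝ fun k => x (b k)
  have hT : T.Nonempty := by
    obtain ⟨f, hf, -, hli⟩ := Submodule.exists_fun_fin_finrank_span_eq ℝ (range x)
    have hrank : Module.finrank ℝ (Submodule.span ℝ (range x)) = n := by
      rw [hx, finrank_top, Module.finrank_fin_fun]
    choose b hb using hf
    refine ⟨fun k => b (Fin.cast hrank.symm k), Finset.mem_filter.2 ⟨Finset.mem_univ _, ?_⟩⟩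
    simp only [hb]
    exact hli.comp _ (Fin.cast_injective _)
  -- Maximality yields an exchange argument: if `x j` involves `x (b k)`, swapping the two keeps
  -- independence, so `s j` cannot exceed `s (b k)`.
  obtain ⟨b, hbT, hmax⟩ := T.exists_max_image (fun b => ∏ k, s (b k)) hT
  have hli : LinearIndependent ℝ fun k => x (b k) := (Finset.mem_filter.1 hbT).2
  refine ⟨b, hli, fun j => ?_⟩
  have hspan : ⊤ ≤ Submodule.span ℝ (range fun k => x (b k)) :=
    (hli.span_eq_top_of_card_eq_finrank' (by simp)).ge
  set B := Module.Basis.mk hli hspan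
  have hsum : x j = ∑ k, B.repr (x j) k • x (b k) := by
    conv_lhs => rw [← B.sum_repr (x j)]
    simp [B]
  rw [hsum]
  refine Submodule.sum_mem _ fun k _ => ?_
  by_cases hk : B.repr (x j) k = 0
  · rw [hk, zero_smul]
    exact Submodule.zero_mem _
  refine Submodule.smul_mem _ _ (Submodule.subset_span ⟨k, ?_, rfl⟩)
  by_contra hlt
  have hlt' : s (b k) < s j := not_le.1 hlt
  have hupd : (fun l => x (Function.update b k j l)) = Function.update (fun l => x (b l)) k (x j) := by
    ext1 l
    by_cases hl : l = k
    · subst hl; simp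
    · simp [hl]
  have hmem : Function.update b k j ∈ T := by
    refine Finset.mem_filter.2 ⟨Finset.mem_univ _, ?_⟩
    rw [hupd]
    refine hli.update k (x j) ⟨1, one_mem _, B.repr (x j), mem_nonZeroDivisors_of_ne_zero hk, ?_⟩
    rw [one_smul, Finsupp.linearCombination_apply, Finsupp.sum_fintype _ _ (by simp)]
    exact hsum
  have h := hmax _ hmem
  rw [← Finset.mul_prod_erase _ _ (Finset.mem_univ k),
    ← Finset.mul_prod_erase (a := k) _ (fun l => s (b l)) (Finset.mem_univ k)] at h
  have heq : ∏ l ∈ Finset.univ.erase k, s (Function.update b k j l)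
      = ∏ l ∈ Finset.univ.erase k, s (b l) :=
    Finset.prod_congr rfl fun l hl => by rw [Function.update_of_ne (Finset.ne_of_mem_erase hl)]
  rw [heq, Function.update_self] at h
  have hpos : 0 < ∏ l ∈ Finset.univ.erase k, s (b l) := Finset.prod_pos fun l _ => hs _
  exact absurd (le_of_mul_le_mul_right h hpos) (not_le.2 hlt')

/-- Symmetric matrices supported on a subspace of dimension `r` span a space of dimension at most
`r (r + 1) / 2`. -/
lemma card_le_choose_of_mem_span {n : ℕ} {κ ι : Type*} [Fintype ι] (B : Finset κ)
    (y : κ → Fin n → ℝ) {X : ι → Matrix (Fin n) (Fin n) ℝ} (hX : LinearIndependent ℝ X)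
    (hmem : ∀ i, X i ∈ Submodule.span ℝ
      ((fun u => Matrix.vecMulVec u u) '' (Submodule.span ℝ (y '' B) : Set (Fin n → ℝ)))) :
    Fintype.card ι ≤ (B.card + 1).choose 2 := by
  classical
  -- The symmetrized products of the spanning vectors, indexed by unordered pairs with repetition,
  -- span the relevant symmetric matrices.
  set f : Sym2 κ → Matrix (Fin n) (Fin n) ℝ := Sym2.lift
    ⟨fun k l => Matrix.vecMulVec (y k) (y l) + Matrix.vecMulVec (y l) (y k),
      fun k l => add_comm _ _⟩
  set F : Finset (Matrix (Fin n) (Fin n) ℝ) := B.sym2.image f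
  have hle : Submodule.span ℝ
      ((fun u => Matrix.vecMulVec u u) '' (Submodule.span ℝ (y '' B) : Set (Fin n → ℝ)))
      ≤ Submodule.span ℝ (F : Set (Matrix (Fin n) (Fin n) ℝ)) := by
    rw [Submodule.span_le]
    rintro _ ⟨u, hu, rfl⟩
    obtain ⟨c, hc⟩ := (Submodule.mem_span_image_finset_iff_exists_fun ℝ).1 hu
    have hsum : Matrix.vecMulVec u u = ∑ k : B, ∑ l : B, (c k * c l / 2) • f s(k.1, l.1) := by
      have h1 : Matrix.vecMulVec u u
          = ∑ k : B, ∑ l : B, (c k * c l) • Matrix.vecMulVec (y k.1) (y l.1) := by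
        ext i j
        simp only [← hc, Matrix.vecMulVec_apply, Finset.sum_apply, Pi.smul_apply, smul_eq_mul,
          Matrix.sum_apply, Matrix.smul_apply, Finset.sum_mul_sum]
        exact Finset.sum_congr rfl fun k _ => Finset.sum_congr rfl fun l _ => by ring
      have h2 : ∑ k : B, ∑ l : B, (c k * c l / 2) • Matrix.vecMulVec (y l.1) (y k.1)
          = ∑ k : B, ∑ l : B, (c k * c l / 2) • Matrix.vecMulVec (y k.1) (y l.1) := by
        rw [Finset.sum_comm]
        exact Finset.sum_congr rfl fun k _ => Finset.sum_congr rfl fun l _ => by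
          rw [mul_comm (c l)]
      simp only [f, Sym2.lift_mk, smul_add, Finset.sum_add_distrib]
      rw [h2, h1, ← Finset.sum_add_distrib]
      refine Finset.sum_congr rfl fun k _ => ?_
      rw [← Finset.sum_add_distrib]
      refine Finset.sum_congr rfl fun l _ => ?_
      rw [← add_smul, add_halves]
    change Matrix.vecMulVec u u ∈ Submodule.span ℝ (F : Set (Matrix (Fin n) (Fin n) ℝ))
    rw [hsum]
    refine Submodule.sum_mem _ fun k _ => Submodule.sum_mem _ fun l _ =>
      Submodule.smul_mem _ _ (Submodule.subset_span ?_)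
    exact Finset.mem_coe.2 (Finset.mem_image_of_mem _ (Finset.mk_mem_sym2_iff.2 ⟨k.2, l.2⟩))
  calc Fintype.card ι = Module.finrank ℝ (Submodule.span ℝ (range X)) :=
        (finrank_span_eq_card hX).symm
    _ ≤ Module.finrank ℝ (Submodule.span ℝ (F : Set (Matrix (Fin n) (Fin n) ℝ))) := by
        refine Submodule.finrank_mono (Submodule.span_le.2 ?_)
        rintro _ ⟨i, rfl⟩
        exact hle (hmem i)
    _ ≤ F.card := finrank_span_finset_le_card F
    _ ≤ B.sym2.card := Finset.card_image_le
    _ = (B.card + 1).choose 2 := Finset.card_sym2 B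

/-! ### Layer counting and the integrable majorant -/

/-- Summation by layers. -/
lemma sum_mul_nonneg_of_layers {ι : Type*} [Fintype ι] {c L : ι → ℝ} (hL : ∀ i, 0 ≤ L i)
    (h : ∀ u : ℝ, 0 ≤ u → 0 ≤ ∑ i with u < L i, c i) : 0 ≤ ∑ i, c i * L i := by
  classical
  have hint : ∀ i, Integrable ((Ico 0 (L i)).indicator fun _ : ℝ => c i) := fun i =>
    (integrable_indicator_iff measurableSet_Ico).2
      (integrableOn_const (by simp))
  -- Layer-cake formula: the sum becomes an integral over u of the layer sums, each nonnegative by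
  -- hypothesis.
  have h1 : ∀ i, c i * L i = ∫ u, (Ico 0 (L i)).indicator (fun _ : ℝ => c i) u := by
    intro i
    rw [integral_indicator measurableSet_Ico, setIntegral_const, Real.volume_real_Ico_of_le (hL i),
      sub_zero, smul_eq_mul, mul_comm]
  simp only [h1]
  rw [← integral_finsetSum _ fun i _ => hint i]
  refine integral_nonneg fun u => ?_
  simp only [Pi.zero_apply]
  by_cases hu : 0 ≤ u
  · have := h u hu
    rw [Finset.sum_filter] at this
    refine this.trans_eq (Finset.sum_congr rfl fun i _ => ?_)
    simp [indicator, hu]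
  · refine le_of_eq (Finset.sum_eq_zero fun i _ => ?_).symm
    simp [indicator, hu]

/-- A nonzero vector orthogonal to all `x j` would lie in the kernel of the sum. -/
lemma span_eq_top_of_posDef {n : ℕ} {J : Type*} [Fintype J] {s : J → ℝ} {x : J → Fin n → ℝ}
    (h : (∑ j, s j • Matrix.vecMulVec (x j) (x j)).PosDef) :
    Submodule.span ℝ (range x) = ⊤ := by
  by_contra hne
  obtain ⟨f, hf, hker⟩ := Submodule.exists_le_ker_of_lt_top _ (lt_top_iff_ne_top.2 hne)
  set y : Fin n → ℝ := fun i => f (Pi.single i 1)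
  have hfy : ∀ v : Fin n → ℝ, f v = v ⬝ᵥ y := by
    intro v
    conv_lhs => rw [← sum_smul_single v]
    simp [dotProduct, y]
  have hy : y ≠ 0 := by
    intro h0
    apply hf
    ext i
    simpa [y] using congrFun h0 i
  have hpos := h.dotProduct_mulVec_pos hy
  have hzero : star y ⬝ᵥ ((∑ j, s j • Matrix.vecMulVec (x j) (x j)) *ᵥ y) = 0 := by
    rw [Matrix.sum_mulVec]
    have : ∀ j, (s j • Matrix.vecMulVec (x j) (x j)) *ᵥ y = 0 := by
      intro j
      have hj : x j ⬝ᵥ y = 0 := by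
        rw [← hfy]
        exact hker (Submodule.subset_span ⟨j, rfl⟩)
      rw [Matrix.smul_mulVec, Matrix.vecMulVec_mulVec, hj]
      simp
    simp [this]
  exact hpos.ne' hzero

/-- The source of the exponent (n+1)/(n+2): 2(N - q) ≥ n(n+1) - r(r+1) = (n-r)(n+r+1) ≥ (n-r)(n+2),
the last step because q ≥ 1 forces r ≥ 1. -/
lemma layer_card_bound {n q r N : ℕ} (hq : 1 ≤ q) (hqr : q ≤ (r + 1).choose 2) (hrn : r ≤ n)
    (hN : 2 * N = n * (n + 1)) :
    ((n : ℝ) + 1) / 2 * (n - r) ≤ ((n : ℝ) + 1) / (n + 2) * (N - q) := by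
  have hr : 1 ≤ r := by
    by_contra! h
    have : r = 0 := by omega
    subst this
    simp at hqr
    omega
  have h2 : 2 * q ≤ (r + 1) * r := by
    have := Nat.triangle_succ r
    rw [Nat.choose_two_right, Nat.add_sub_cancel] at hqr
    calc 2 * q ≤ 2 * ((r + 1) * r / 2) := by omega
      _ ≤ (r + 1) * r := Nat.mul_div_le _ _
  have h2' : 2 * (q : ℝ) ≤ (r + 1) * r := by exact_mod_cast h2
  have hN' : 2 * (N : ℝ) = n * (n + 1) := by exact_mod_cast hN
  have hr' : (1 : ℝ) ≤ r := by exact_mod_cast hr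
  have hrn' : (r : ℝ) ≤ n := by exact_mod_cast hrn
  have key : ((n : ℝ) - r) * (n + 2) ≤ 2 * (N - q) := by
    nlinarith [mul_nonneg (sub_nonneg.2 hrn') (sub_nonneg.2 hr')]
  rw [div_mul_eq_mul_div, div_mul_eq_mul_div, div_le_div_iff₀ (by norm_num) (by positivity)]
  have hn : (0 : ℝ) ≤ n + 1 := by positivity
  nlinarith [mul_le_mul_of_nonneg_left key hn]

/-- The weight of a basis of maximal weight is controlled by all the weights. -/
lemma prod_rpow_basis_le {n : ℕ} {ι : Type*} [Fintype ι] (hN : 2 * Fintype.card ι = n * (n + 1))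
    {t : ι → ℝ} (ht : ∀ i, 0 < t i) (ht1 : ∀ i, t i ≤ 1) (htmax : ∃ i, 1 / 2 ≤ t i)
    (β : Fin n → ι)
    (hcard : ∀ a : ℝ, (Finset.univ.filter fun i => a ≤ t i).card
      ≤ ((Finset.univ.filter fun k => a ≤ t (β k)).card + 1).choose 2) :
    (∏ k, t (β k)) ^ (-((n : ℝ) + 1) / 2)
      ≤ 2 ^ Fintype.card ι * ∏ i, t i ^ (-(((n : ℝ) + 1) / (n + 2))) := by
  obtain ⟨i₁, hi₁⟩ := htmax
  obtain ⟨i₀, -, hi₀⟩ := Finset.univ.exists_max_image t ⟨i₁, Finset.mem_univ i₁⟩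
  have hi₀' : ∀ i, t i ≤ t i₀ := fun i => hi₀ i (Finset.mem_univ i)
  set τ := t i₀ with hτ
  have hτ2 : 1 / 2 ≤ τ := hi₁.trans (hi₀' i₁)
  have hτ0 : 0 < τ := ht i₀
  have hτ1 : τ ≤ 1 := ht1 i₀
  set γ : ℝ := ((n : ℝ) + 1) / (n + 2) with hγ
  have hγ0 : 0 ≤ γ := by positivity
  have hγ1 : γ ≤ 1 := by
    rw [hγ, div_le_one (by positivity)]
    linarith
  set L : ι → ℝ := fun i => Real.log τ - Real.log (t i) with hL
  have hL0 : ∀ i, 0 ≤ L i := fun i => sub_nonneg.2 (Real.log_le_log (ht i) (hi₀' i))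
  -- After taking logarithms the claim compares γ ∑ L_i with (n+1)/2 times the sum of L over the
  -- basis. Both are put into one signed sum, so that each layer is a counting inequality.
  have hlayer := sum_mul_nonneg_of_layers (ι := ι ⊕ Fin n)
    (c := Sum.elim (fun _ => γ) (fun _ => -(((n : ℝ) + 1) / 2)))
    (L := Sum.elim L (fun k => L (β k)))
    (by rintro (i | k); exacts [hL0 i, hL0 _]) (by
      intro u hu
      set a : ℝ := τ * Real.exp (-u) with ha
      have ha0 : 0 < a := by positivity
      have hiff : ∀ i, u < L i ↔ ¬ a ≤ t i := by
        intro i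
        rw [← Real.log_le_log_iff ha0 (ht i), ha, Real.log_mul hτ0.ne' (Real.exp_pos _).ne',
          Real.log_exp, not_le, hL]
        constructor <;> intro h <;> linarith
      -- The largest coordinate reaches every level a = τ e⁻ᵘ; this is why `L` is measured from τ
      -- rather than from 1.
      have hq : 1 ≤ (Finset.univ.filter fun i => a ≤ t i).card := by
        refine Finset.card_pos.2 ⟨i₀, Finset.mem_filter.2 ⟨Finset.mem_univ _, ?_⟩⟩
        rw [ha]
        exact mul_le_of_le_one_right hτ0.le (Real.exp_le_one_iff.2 (by linarith))
      have hrn : (Finset.univ.filter fun k => a ≤ t (β k)).card ≤ n := by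
        simpa using Finset.card_filter_le (Finset.univ : Finset (Fin n)) fun k => a ≤ t (β k)
      have hb := layer_card_bound hq (hcard a) hrn hN
      have h1 : ((Finset.univ.filter fun i => ¬ a ≤ t i).card : ℝ)
          = Fintype.card ι - (Finset.univ.filter fun i => a ≤ t i).card := by
        rw [eq_sub_iff_add_eq', ← Nat.cast_add, Finset.card_filter_add_card_filter_not,
          Finset.card_univ]
      have h2 : ((Finset.univ.filter fun k => ¬ a ≤ t (β k)).card : ℝ)
          = n - (Finset.univ.filter fun k => a ≤ t (β k)).card := by
        rw [eq_sub_iff_add_eq', ← Nat.cast_add, Finset.card_filter_add_card_filter_not,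
          Finset.card_univ, Fintype.card_fin]
      rw [Finset.sum_filter, Fintype.sum_sum_type]
      simp only [Sum.elim_inl, Sum.elim_inr, hiff]
      rw [← Finset.sum_filter, ← Finset.sum_filter, Finset.sum_const, Finset.sum_const,
        nsmul_eq_mul, nsmul_eq_mul, h1, h2]
      linarith)
  rw [Fintype.sum_sum_type] at hlayer
  simp only [Sum.elim_inl, Sum.elim_inr] at hlayer
  rw [← Finset.mul_sum, ← Finset.mul_sum] at hlayer
  have hprod : 0 < ∏ k, t (β k) := Finset.prod_pos fun k _ => ht _
  have hprod2 : ∀ i, 0 < t i ^ (-γ) := fun i => Real.rpow_pos_of_pos (ht i) _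
  have hprod3 : 0 < ∏ i, t i ^ (-γ) := Finset.prod_pos fun i _ => hprod2 i
  rw [← Real.log_le_log_iff (Real.rpow_pos_of_pos hprod _) (by positivity),
    Real.log_rpow hprod, Real.log_mul (by positivity) hprod3.ne', Real.log_pow,
    Real.log_prod (fun k _ => (ht _).ne'), Real.log_prod (fun i _ => (hprod2 i).ne')]
  simp only [Real.log_rpow (ht _)]
  rw [← Finset.mul_sum]
  simp only [hL, Finset.sum_sub_distrib, Finset.sum_const, Finset.card_univ, Fintype.card_fin,
    nsmul_eq_mul] at hlayer
  have hN' : 2 * (Fintype.card ι : ℝ) = n * (n + 1) := by exact_mod_cast hN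
  set N : ℝ := (Fintype.card ι : ℝ) with hNdef
  have hN0 : 0 ≤ N := Nat.cast_nonneg _
  set lt := Real.log τ
  have hlt0 : lt ≤ 0 := Real.log_nonpos hτ0.le hτ1
  have hlt2 : -Real.log 2 ≤ lt := by
    rw [← Real.log_inv]
    exact Real.log_le_log (by norm_num) (by rwa [← one_div])
  -- The terms in log τ leave an error (1 - γ) N (-log τ), which is at most N log 2 because τ ≥ 1/2;
  -- it accounts for the factor 2^N.
  have h3 : ((n : ℝ) + 1) / 2 * (n * lt) = N * lt := by
    have : N = n * (n + 1) / 2 := by linarith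
    rw [this]; ring
  have h4 : (1 - γ) * (N * -lt) ≤ N * Real.log 2 := by
    calc (1 - γ) * (N * -lt) ≤ 1 * (N * -lt) :=
          mul_le_mul_of_nonneg_right (by linarith) (mul_nonneg hN0 (by linarith))
      _ ≤ N * Real.log 2 := by
          rw [one_mul]
          exact mul_le_mul_of_nonneg_left (by linarith) hN0
  nlinarith

/-- The invariant density on a simplicial cone with positive semidefinite generators is bounded
by a product of integrable powers of the coordinates. -/
lemma exists_det_rpow_le {n : ℕ} {ι : Type*} [Fintype ι]
    (hN : 2 * Fintype.card ι = n * (n + 1)) {X : ι → Matrix (Fin n) (Fin n) ℝ}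
    (hX : LinearIndependent ℝ X) (hpsd : ∀ i, (X i).PosSemidef) :
    ∃ C : ℝ, ∀ t : ι → ℝ, (∀ i, 0 < t i) → (∀ i, t i ≤ 1) → (∃ i, 1 / 2 ≤ t i) →
      (∑ i, t i • X i).PosDef → (∑ i, t i • X i).det ^ (-((n : ℝ) + 1) / 2)
        ≤ C * ∏ i, t i ^ (-(((n : ℝ) + 1) / (n + 2))) := by
  classical
  have hdec := fun i => Matrix.posSemidef_iff_eq_sum_vecMulVec.1 (hpsd i)
  choose m w hw using hdec
  set x : (Σ i, Fin (m i)) → Fin n → ℝ := fun j => w j.1 j.2 with hx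
  have hXx : ∀ i, X i = ∑ k, Matrix.vecMulVec (x ⟨i, k⟩) (x ⟨i, k⟩) := fun i => by
    rw [hw i]
    rfl
  -- The chosen basis varies with `t`, so the constant sums over all finitely many selections `b`;
  -- singular ones merely add nonnegative terms.
  set D : (Fin n → Σ i, Fin (m i)) → ℝ :=
    fun b => ((Matrix.of fun k => x (b k)).det ^ 2) ^ (-((n : ℝ) + 1) / 2) with hD
  have hD0 : ∀ b, 0 ≤ D b := fun b => Real.rpow_nonneg (sq_nonneg _) _
  refine ⟨(∑ b, D b) * 2 ^ Fintype.card ι, fun t ht ht1 htmax hpd => ?_⟩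
  have hsum : ∑ i, t i • X i = ∑ j : Σ i, Fin (m i), t j.1 • Matrix.vecMulVec (x j) (x j) := by
    rw [Fintype.sum_sigma]
    exact Finset.sum_congr rfl fun i _ => by rw [hXx i, Finset.smul_sum]
  rw [hsum] at hpd ⊢
  obtain ⟨b, hb, hbspan⟩ := exists_basis_of_max_weight (span_eq_top_of_posDef hpd)
    (s := fun j => t j.1) fun j => ht _
  have hbinj : Function.Injective b := fun k l h =>
    hb.injective (show x (b k) = x (b l) by rw [h])
  have hdet : (Matrix.of fun k => x (b k)).det ≠ 0 :=
    ((Matrix.isUnit_iff_isUnit_det _).1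
      (Matrix.linearIndependent_rows_iff_isUnit.1 hb)).ne_zero
  have hle := prod_mul_det_sq_le_det_sum (s := fun j : Σ i, Fin (m i) => t j.1)
    (fun j => (ht j.1).le) x hbinj
  have hprod : 0 < ∏ k, t (b k).1 := Finset.prod_pos fun k _ => ht _
  -- The level count: for t_i ≥ a, every rank-one constituent of `X i` lies over the span of the
  -- basis vectors of weight at least a, and the `X i` are independent.
  have hbasis := prod_rpow_basis_le hN ht ht1 htmax (fun k => (b k).1) (by
    intro a
    have hli : LinearIndependent ℝ fun i : {i // a ≤ t i} => X i :=
      hX.comp _ Subtype.val_injective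
    have := card_le_choose_of_mem_span (Finset.univ.filter fun k => a ≤ t (b k).1)
      (fun k => x (b k)) hli (by
        rintro ⟨i, hi⟩
        simp only
        rw [hXx i]
        refine Submodule.sum_mem _ fun k _ => Submodule.subset_span ⟨x ⟨i, k⟩, ?_, rfl⟩
        refine Submodule.span_mono (image_mono fun l hl => ?_) (hbspan ⟨i, k⟩)
        simp only [Finset.coe_filter, Finset.mem_univ, true_and]
        exact hi.trans hl)
    rwa [Fintype.card_subtype] at this)
  have hexp : -((n : ℝ) + 1) / 2 ≤ 0 := by
    have : (0 : ℝ) ≤ n := Nat.cast_nonneg n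
    linarith
  calc (∑ j : Σ i, Fin (m i), t j.1 • Matrix.vecMulVec (x j) (x j)).det ^ (-((n : ℝ) + 1) / 2)
      ≤ ((∏ k, t (b k).1) * (Matrix.of fun k => x (b k)).det ^ 2) ^ (-((n : ℝ) + 1) / 2) :=
        Real.rpow_le_rpow_of_nonpos (by positivity) hle hexp
    _ = (∏ k, t (b k).1) ^ (-((n : ℝ) + 1) / 2) * D b :=
        Real.mul_rpow hprod.le (sq_nonneg _)
    _ ≤ (2 ^ Fintype.card ι * ∏ i, t i ^ (-(((n : ℝ) + 1) / (n + 2)))) * ∑ b, D b := by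
        refine mul_le_mul hbasis (Finset.single_le_sum (fun b _ => hD0 b) (Finset.mem_univ b))
          (hD0 b) ?_
        exact mul_nonneg (by positivity)
          (Finset.prod_nonneg fun i _ => Real.rpow_nonneg (ht i).le _)
    _ = _ := by ring

/-- The part of a simplicial cone with positive semidefinite generators where the largest
coordinate is between `1/2` and `1` has finite invariant measure. -/
lemma invMeasure_simplicial_lt_top {n : ℕ} [NeZero n] {Φ : (FullIdx n → ℝ) →ₗ[ℝ] (FullIdx n → ℝ)}
    (hΦ : Function.Injective Φ) (hpsd : ∀ a, (symOf (Φ (Pi.single a 1))).PosSemidef) :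
    invMeasure n (Φ '' {t | (∀ a, 0 ≤ t a) ∧ (∀ a, t a ≤ 1) ∧ ∃ a, 1 / 2 ≤ t a}) < ⊤ := by
  set T : Set (FullIdx n → ℝ) := {t | (∀ a, 0 ≤ t a) ∧ (∀ a, t a ≤ 1) ∧ ∃ a, 1 / 2 ≤ t a} with hT
  have hTm : MeasurableSet T := by
    have h1 : T = (⋂ a, {t | 0 ≤ t a}) ∩ (⋂ a, {t | t a ≤ 1}) ∩ ⋃ a, {t | 1 / 2 ≤ t a} := by
      ext t
      simp [hT, and_assoc]
    rw [h1]
    refine ((MeasurableSet.iInter fun a => ?_).inter (MeasurableSet.iInter fun a => ?_)).inter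
      (MeasurableSet.iUnion fun a => ?_)
    · exact measurableSet_le measurable_const (measurable_pi_apply a)
    · exact measurableSet_le (measurable_pi_apply a) measurable_const
    · exact measurableSet_le measurable_const (measurable_pi_apply a)
  have hΦc : Continuous Φ := LinearMap.continuous_of_finiteDimensional Φ
  have hemb : MeasurableEmbedding Φ := hΦc.measurableEmbedding hΦ
  have hsymΦ : ∀ t, symOf (Φ t) = ∑ a, t a • symOf (Φ (Pi.single a 1)) := by
    intro t
    conv_lhs => rw [← sum_smul_single t]
    simp
  have hli : LinearIndependent ℝ fun a => symOf (Φ (Pi.single a 1)) := by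
    have h1 : LinearIndependent ℝ fun a : FullIdx n => (Pi.single a 1 : FullIdx n → ℝ) :=
      Pi.linearIndependent_single_one _ _
    have h2 := h1.map' (symOf ∘ₗ Φ) (LinearMap.ker_eq_bot.2 (symOf_injective.comp hΦ))
    exact h2
  obtain ⟨C, hC⟩ := exists_det_rpow_le card_fullIdx hli hpsd
  set γ : ℝ := ((n : ℝ) + 1) / (n + 2) with hγ
  have hpre : MeasurableSet (Φ ⁻¹' posCone n) := hΦc.measurable (isOpen_posCone n).measurableSet
  have himg : Φ '' T ∩ posCone n = Φ '' (T ∩ Φ ⁻¹' posCone n) := (image_inter_preimage _ _ _).symm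
  rw [invMeasure_apply (hemb.measurableSet_image.2 hTm), himg,
    lintegral_image_eq_lintegral_abs_det_fderiv_mul volume (hTm.inter hpre)
      (f := Φ) (f' := fun _ => LinearMap.toContinuousLinearMap Φ)
      (fun v _ => (LinearMap.toContinuousLinearMap Φ).hasFDerivWithinAt) hΦ.injOn,
    lintegral_const_mul' _ _ ENNReal.ofReal_ne_top]
  refine ENNReal.mul_lt_top ENNReal.ofReal_lt_top ?_
  -- γ < 1 makes each factor integrable at 0. The faces t_a = 0, where the bound is not available,
  -- are null sets.
  set q : (FullIdx n → ℝ) → ℝ := fun t => ∏ a, (Ioc (0 : ℝ) 1).indicator (fun r => r ^ (-γ)) (t a)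
    with hq
  have hqint : Integrable q := by
    refine Integrable.fintype_prod (f := fun _ : FullIdx n =>
      (Ioc (0 : ℝ) 1).indicator fun r => r ^ (-γ)) (fun a => ?_)
    rw [integrable_indicator_iff measurableSet_Ioc,
      ← intervalIntegrable_iff_integrableOn_Ioc_of_le zero_le_one]
    refine intervalIntegral.intervalIntegrable_rpow' ?_
    rw [neg_lt_neg_iff, hγ, div_lt_one (by positivity)]
    linarith
  have hae : ∀ᵐ t : FullIdx n → ℝ, ∀ a, t a ≠ 0 := by
    rw [ae_all_iff]
    intro a
    have : volume ((fun t : FullIdx n → ℝ => t a) ⁻¹' {0}) = 0 :=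
      (Measure.quasiMeasurePreserving_eval _ a).preimage_null (by simp)
    rw [ae_iff]
    simp only [ne_eq, not_not]
    exact this
  calc ∫⁻ t in T ∩ Φ ⁻¹' posCone n, invDensity (symOf (Φ t))
      ≤ ∫⁻ t in T ∩ Φ ⁻¹' posCone n, ENNReal.ofReal (C * q t) := by
        refine lintegral_mono_ae ?_
        rw [ae_restrict_iff' (hTm.inter hpre)]
        filter_upwards [hae] with t ht0 ht
        obtain ⟨⟨h0, h1, h2⟩, hpos⟩ := ht
        have h0' : ∀ a, 0 < t a := fun a => (h0 a).lt_of_ne' (ht0 a)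
        have hpd : (∑ a, t a • symOf (Φ (Pi.single a 1))).PosDef := by
          rw [← hsymΦ]
          exact hpos
        have hqt : q t = ∏ a, t a ^ (-γ) :=
          Finset.prod_congr rfl fun a _ => 
            indicator_of_mem (show t a ∈ Ioc (0 : ℝ) 1 from ⟨h0' a, h1 a⟩) _
        rw [invDensity, hsymΦ, hqt]
        exact ENNReal.ofReal_le_ofReal (hC t h0' h1 h2 hpd)
    _ ≤ ∫⁻ t, ENNReal.ofReal (C * q t) := setLIntegral_le_lintegral _ _
    _ < ⊤ := (hqint.const_mul C).lintegral_lt_top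

/-! ### Polyhedral cones: generators and simplicial covers -/

section Cones

variable {E : Type*} [AddCommGroup E] [Module ℝ E]

lemma smul_mem_hull {V : Set E} {c : ℝ} (hc : 0 ≤ c) {x : E} (hx : x ∈ PointedCone.hull ℝ V) :
    c • x ∈ PointedCone.hull ℝ V := (PointedCone.hull ℝ V).smul_mem hc hx

lemma mem_hull_finset {V : Finset E} {x : E} :
    x ∈ PointedCone.hull ℝ (V : Set E) ↔
      ∃ c : E → ℝ, (∀ v ∈ V, 0 ≤ c v) ∧ ∑ v ∈ V, c v • v = x := by
  constructor
  · intro hx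
    obtain ⟨c, hcV, hc0, hsum⟩ := PointedCone.mem_hull_set.1 hx
    refine ⟨c, fun v _ => hc0 v, ?_⟩
    rw [← hsum, Finsupp.sum]
    refine (Finset.sum_subset (fun v hv => ?_) fun v _ hv => ?_).symm
    · exact Finset.mem_coe.1 (hcV (Finset.mem_coe.2 hv))
    · rw [Finsupp.notMem_support_iff.1 hv, zero_smul]
  · rintro ⟨c, hc, rfl⟩
    exact Submodule.sum_mem _ fun v hv => smul_mem_hull (hc v hv) (PointedCone.subset_hull hv)

/-- Minkowski's theorem: polyhedral cones are finitely generated. -/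
lemma exists_hull_eq_of_dual [Module.Finite ℝ E] (s : Finset (Module.Dual ℝ E)) :
    ∃ V : Finset E, ∀ x, x ∈ PointedCone.hull ℝ (V : Set E) ↔ ∀ l ∈ s, 0 ≤ l x := by
  classical
  induction s using Finset.induction_on with
  | empty =>
    set b := Module.finBasis ℝ E
    refine ⟨Finset.univ.image b ∪ Finset.univ.image (fun i => -b i), fun x => ?_⟩
    simp only [Finset.notMem_empty, false_implies, implies_true, iff_true]
    rw [← b.sum_repr x]
    refine Submodule.sum_mem _ fun i _ => ?_
    rcases le_total 0 (b.repr x i) with h | h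
    · exact smul_mem_hull h (PointedCone.subset_hull (by simp))
    · rw [← neg_smul_neg]
      exact smul_mem_hull (neg_nonneg.2 h) (PointedCone.subset_hull (by simp))
  | insert l s hl ih =>
    obtain ⟨V, hV⟩ := ih
    -- Fourier–Motzkin elimination: keep the generators on the side l ≥ 0, and add for each pair
    -- from opposite sides its combination in the hyperplane l = 0.
    set P := V.filter fun v => 0 ≤ l v with hP
    set M := V.filter fun v => ¬ 0 ≤ l v with hM
    set R := (P ×ˢ M).image fun p : E × E => l p.1 • p.2 + (-l p.2) • p.1 with hR
    have hPl : ∀ v ∈ P, 0 ≤ l v := fun v hv => (Finset.mem_filter.1 hv).2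
    have hMl : ∀ v ∈ M, 0 < -l v := fun v hv => neg_pos.2 (not_le.1 (Finset.mem_filter.1 hv).2)
    have hPV : ∀ v ∈ P, v ∈ PointedCone.hull ℝ (V : Set E) := fun v hv =>
      PointedCone.subset_hull (Finset.mem_filter.1 hv).1
    have hMV : ∀ v ∈ M, v ∈ PointedCone.hull ℝ (V : Set E) := fun v hv =>
      PointedCone.subset_hull (Finset.mem_filter.1 hv).1
    refine ⟨P ∪ R, fun x => ⟨fun hx => ?_, fun hx => ?_⟩⟩
    · have hgen : ∀ v ∈ P ∪ R, v ∈ PointedCone.hull ℝ (V : Set E) ∧ 0 ≤ l v := by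
        intro v hv
        rcases Finset.mem_union.1 hv with h | h
        · exact ⟨hPV v h, hPl v h⟩
        · obtain ⟨⟨p, q⟩, hpq, rfl⟩ := Finset.mem_image.1 h
          obtain ⟨hp, hq⟩ := Finset.mem_product.1 hpq
          refine ⟨Submodule.add_mem _ (smul_mem_hull (hPl p hp) (hMV q hq))
            (smul_mem_hull (hMl q hq).le (hPV p hp)), le_of_eq ?_⟩
          simp only [map_add, map_smul, smul_eq_mul]
          ring
      obtain ⟨c, hc, rfl⟩ := mem_hull_finset.1 hx
      intro l' hl'
      rcases Finset.mem_insert.1 hl' with rfl | hl'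
      · rw [map_sum]
        refine Finset.sum_nonneg fun v hv => ?_
        rw [map_smul, smul_eq_mul]
        exact mul_nonneg (hc v hv) (hgen v hv).2
      · refine (hV _).1 (Submodule.sum_mem _ fun v hv => ?_) l' hl'
        exact smul_mem_hull (hc v hv) (hgen v hv).1
    · have hxV : x ∈ PointedCone.hull ℝ (V : Set E) :=
        (hV x).2 fun l' hl' => hx l' (Finset.mem_insert_of_mem hl')
      have hlx : 0 ≤ l x := hx l (Finset.mem_insert_self _ _)
      obtain ⟨c, hc, rfl⟩ := mem_hull_finset.1 hxV
      have hcP : ∀ v ∈ P, 0 ≤ c v := fun v hv => hc v (Finset.mem_filter.1 hv).1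
      have hcM : ∀ v ∈ M, 0 ≤ c v := fun v hv => hc v (Finset.mem_filter.1 hv).1
      have hsplit : ∑ v ∈ V, c v • v = ∑ v ∈ P, c v • v + ∑ w ∈ M, c w • w :=
        (Finset.sum_filter_add_sum_filter_not V _ _).symm
      set a := ∑ v ∈ P, c v * l v with ha
      set b := ∑ w ∈ M, c w * -l w with hb
      have ha0 : 0 ≤ a := Finset.sum_nonneg fun v hv => mul_nonneg (hcP v hv) (hPl v hv)
      have hb0 : 0 ≤ b := Finset.sum_nonneg fun v hv => mul_nonneg (hcM v hv) (hMl v hv).le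
      have hba : b ≤ a := by
        rw [hsplit, map_add, map_sum, map_sum] at hlx
        simp only [map_smul, smul_eq_mul] at hlx
        rw [hb]
        simp only [mul_neg, Finset.sum_neg_distrib]
        linarith
      have hPmem : ∑ v ∈ P, c v • v ∈ PointedCone.hull ℝ ((P ∪ R : Finset E) : Set E) :=
        Submodule.sum_mem _ fun v hv => smul_mem_hull (hcP v hv)
          (PointedCone.subset_hull (Finset.mem_coe.2 (Finset.mem_union_left _ hv)))
      -- If a = 0 then b = 0, so the generators with l < 0 do not occur in x. Otherwise the sum over
      -- pairs equals a times the negative part plus b times the positive part, and x is recovered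
      -- from it after division by a, using b ≤ a.
      rcases ha0.eq_or_lt with h0 | hapos
      · have hb00 : b = 0 := le_antisymm (hba.trans h0.ge) hb0
        have hcM0 : ∀ w ∈ M, c w = 0 := fun w hw =>
          (mul_eq_zero.1 ((Finset.sum_eq_zero_iff_of_nonneg fun v hv =>
            mul_nonneg (hcM v hv) (hMl v hv).le).1 hb00 w hw)).resolve_right (hMl w hw).ne'
        rw [hsplit, Finset.sum_eq_zero (s := M) fun w hw => by rw [hcM0 w hw, zero_smul], add_zero]
        exact hPmem
      · have hpairs : ∑ v ∈ P, ∑ w ∈ M, (c v * c w) • (l v • w + (-l w) • v)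
            = a • ∑ w ∈ M, c w • w + b • ∑ v ∈ P, c v • v := by
          simp only [smul_add, Finset.sum_add_distrib]
          congr 1
          · rw [ha, Finset.sum_smul]
            refine Finset.sum_congr rfl fun v _ => ?_
            rw [Finset.smul_sum]
            refine Finset.sum_congr rfl fun w _ => ?_
            rw [smul_smul, smul_smul]
            congr 1
            ring
          · rw [Finset.sum_comm, hb, Finset.sum_smul]
            refine Finset.sum_congr rfl fun w _ => ?_
            rw [Finset.smul_sum]
            refine Finset.sum_congr rfl fun v _ => ?_
            rw [smul_smul, smul_smul]
            congr 1
            ring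
        have hRmem : ∑ v ∈ P, ∑ w ∈ M, (c v * c w) • (l v • w + (-l w) • v)
            ∈ PointedCone.hull ℝ ((P ∪ R : Finset E) : Set E) := by
          refine Submodule.sum_mem _ fun v hv => Submodule.sum_mem _ fun w hw =>
            smul_mem_hull (mul_nonneg (hcP v hv) (hcM w hw)) (PointedCone.subset_hull ?_)
          exact Finset.mem_coe.2 (Finset.mem_union_right _
            (Finset.mem_image.2 ⟨(v, w), Finset.mem_product.2 ⟨hv, hw⟩, rfl⟩))
        have hx' : ∑ v ∈ V, c v • v
            = a⁻¹ • (∑ v ∈ P, ∑ w ∈ M, (c v * c w) • (l v • w + (-l w) • v))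
              + (1 - a⁻¹ * b) • ∑ v ∈ P, c v • v := by
          rw [hpairs, hsplit, smul_add, smul_smul, smul_smul, inv_mul_cancel₀ hapos.ne', one_smul,
            sub_smul, one_smul]
          abel
        rw [hx']
        refine Submodule.add_mem _ (smul_mem_hull (inv_nonneg.2 ha0) hRmem)
          (smul_mem_hull ?_ hPmem)
        rw [sub_nonneg, inv_mul_le_iff₀ hapos, mul_one]
        exact hba

/-- Carathéodory's theorem for cones. -/
lemma exists_linearIndepOn_of_mem_hull {V : Finset E} {x : E}
    (hx : x ∈ PointedCone.hull ℝ (V : Set E)) :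
    ∃ T ⊆ V, LinearIndepOn ℝ id (T : Set E) ∧ x ∈ PointedCone.hull ℝ (T : Set E) := by
  classical
  induction hk : V.card generalizing V with
  | zero =>
    have : V = ∅ := Finset.card_eq_zero.1 hk
    subst this
    exact ⟨∅, subset_rfl, by simp, hx⟩
  | succ k ih =>
    by_cases hli : LinearIndepOn ℝ id (V : Set E)
    · exact ⟨V, subset_rfl, hli, hx⟩
    obtain ⟨g, hg, v₀, hv₀, hgv₀⟩ : ∃ g : E → ℝ, ∑ v ∈ V, g v • v = 0 ∧ ∃ v ∈ V, 0 < g v := by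
      rw [linearIndepOn_finset_iff] at hli
      push Not at hli
      obtain ⟨g, hg, v, hv, hgv⟩ := hli
      rcases lt_or_gt_of_ne hgv with h | h
      · refine ⟨fun v => -g v, ?_, v, hv, neg_pos.2 h⟩
        simp only [neg_smul, Finset.sum_neg_distrib]
        simpa using hg
      · exact ⟨g, hg, v, hv, h⟩
    obtain ⟨c, hc, rfl⟩ := mem_hull_finset.1 hx
    -- Subtracting the multiple of the relation with the smallest ratio keeps all coefficients
    -- nonnegative and kills that of `v₁`.
    obtain ⟨v₁, hv₁, hmin⟩ := (V.filter fun v => 0 < g v).exists_min_image (fun v => c v / g v)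
      ⟨v₀, Finset.mem_filter.2 ⟨hv₀, hgv₀⟩⟩
    obtain ⟨hv₁V, hgv₁⟩ := Finset.mem_filter.1 hv₁
    set r := c v₁ / g v₁ with hr
    have hr0 : 0 ≤ r := div_nonneg (hc _ hv₁V) hgv₁.le
    have hmem : ∑ v ∈ V, c v • v ∈ PointedCone.hull ℝ ((V.erase v₁ : Finset E) : Set E) := by
      refine mem_hull_finset.2 ⟨fun v => c v - r * g v, fun v hv => ?_, ?_⟩
      · have hvV := Finset.mem_of_mem_erase hv
        rw [sub_nonneg]
        rcases le_or_gt (g v) 0 with h | h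
        · exact (mul_nonpos_of_nonneg_of_nonpos hr0 h).trans (hc v hvV)
        · rw [← le_div_iff₀ h]
          exact hmin v (Finset.mem_filter.2 ⟨hvV, h⟩)
      · have h0 : (c v₁ - r * g v₁) • v₁ = 0 := by
          rw [hr, div_mul_cancel₀ _ hgv₁.ne', sub_self, zero_smul]
        change ∑ v ∈ V.erase v₁, (c v - r * g v) • v = _
        rw [Finset.sum_erase V (f := fun v => (c v - r * g v) • v) h0]
        simp only [sub_smul, Finset.sum_sub_distrib, mul_smul, ← Finset.smul_sum, hg, smul_zero,
          sub_zero]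
    obtain ⟨T, hT, h1, h2⟩ := ih hmem (by rw [Finset.card_erase_of_mem hv₁V, hk]; rfl)
    exact ⟨T, hT.trans (Finset.erase_subset _ _), h1, h2⟩

/-- A full-dimensional polyhedral cone is a finite union of simplicial cones. -/
lemma exists_simplicial_cover [Module.Finite ℝ E] {ι : Type*} [Fintype ι]
    (hι : Fintype.card ι = Module.finrank ℝ E) (s : Finset (Module.Dual ℝ E))
    (hspan : Submodule.span ℝ {x : E | ∀ l ∈ s, 0 ≤ l x} = ⊤) :
    ∃ V : Finset E, (∀ v ∈ V, ∀ l ∈ s, 0 ≤ l v) ∧ ∀ x : E, (∀ l ∈ s, 0 ≤ l x) →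
      ∃ b : ι → V, LinearIndependent ℝ (fun a => (b a : E)) ∧
        ∃ t : ι → ℝ, (∀ a, 0 ≤ t a) ∧ ∑ a, t a • (b a : E) = x := by
  classical
  obtain ⟨V, hV⟩ := exists_hull_eq_of_dual s
  refine ⟨V, fun v hv => (hV v).1 (PointedCone.subset_hull hv), fun x hx => ?_⟩
  obtain ⟨T, hTV, hTli, hxT⟩ := exists_linearIndepOn_of_mem_hull ((hV x).2 hx)
  have hTV' : (T : Set E) ⊆ V := Finset.coe_subset.2 hTV
  -- Completing `T` to a basis within `V` keeps all generators inside the cone; this is possible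
  -- since the cone, hence `V`, spans.
  set B := hTli.extend hTV' with hB
  have hTB : (T : Set E) ⊆ B := hTli.subset_extend hTV'
  have hBV : B ⊆ V := hTli.extend_subset hTV'
  have hBli : LinearIndepOn ℝ id B := hTli.linearIndepOn_extend hTV'
  have hBfin : B.Finite := V.finite_toSet.subset hBV
  have hBspan : Submodule.span ℝ B = ⊤ := by
    rw [eq_top_iff, ← hspan, Submodule.span_le]
    intro y hy
    have h1 : (V : Set E) ⊆ Submodule.span ℝ B := by
      simpa using hTli.subset_span_extend hTV'
    exact Submodule.span_le.2 h1 (PointedCone.hull_le_span ℝ (V : Set E) ((hV y).2 hy))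
  have := hBfin.fintype
  have hcard : Fintype.card B = Fintype.card ι := by
    have h := finrank_span_eq_card (R := ℝ) (b := fun v : B => (v : E)) hBli
    rw [Subtype.range_coe, hBspan, finrank_top] at h
    rw [hι, h]
  set e : ι ≃ B := Fintype.equivOfCardEq hcard.symm
  refine ⟨fun a => ⟨e a, hBV (e a).2⟩, ?_, ?_⟩
  · exact LinearIndependent.comp (ι := B) (v := fun v => (v : E)) hBli e e.injective
  · have hxB : x ∈ PointedCone.hull ℝ ((hBfin.toFinset : Finset E) : Set E) := by
      rw [hBfin.coe_toFinset]
      exact Submodule.span_mono hTB hxT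
    obtain ⟨c, hc, hcx⟩ := mem_hull_finset.1 hxB
    refine ⟨fun a => c (e a), fun a => hc _ (hBfin.mem_toFinset.2 (e a).2), ?_⟩
    rw [← hcx, e.sum_comp (fun v : B => c v • (v : E))]
    exact (Finset.sum_subtype _ (fun v => hBfin.mem_toFinset) fun v => c v • v).symm

end Cones

/-! ### The finiteness criterion for polyhedral cones -/

/-- The polyhedral cone cut out by finitely many linear inequalities, in coordinates. -/
def polyCone {n : ℕ} (s : Finset (Module.Dual ℝ (FullIdx n → ℝ))) : Set (FullIdx n → ℝ) :=
  {v | ∀ l ∈ s, 0 ≤ l v}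

section PolyCone

variable {n : ℕ} {s : Finset (Module.Dual ℝ (FullIdx n → ℝ))}

lemma isClosed_polyCone : IsClosed (polyCone s) := by
  have : polyCone s = ⋂ l ∈ s, {v | 0 ≤ l v} := by
    ext v
    simp [polyCone]
  rw [this]
  exact isClosed_biInter fun l _ =>
    isClosed_le continuous_const (LinearMap.continuous_of_finiteDimensional l)

lemma convex_polyCone : Convex ℝ (polyCone s) := by
  intro v hv w hw a b ha hb _ l hl
  rw [map_add, map_smul, map_smul]
  exact add_nonneg (mul_nonneg ha (hv l hl)) (mul_nonneg hb (hw l hl))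

lemma smul_mem_polyCone_iff {c : ℝ} (hc : 0 < c) {v : FullIdx n → ℝ} :
    c • v ∈ polyCone s ↔ v ∈ polyCone s := by
  refine forall₂_congr fun l _ => ?_
  rw [map_smul, smul_eq_mul, mul_nonneg_iff_of_pos_left hc]

end PolyCone

lemma invMeasure_inter_posCone {n : ℕ} {A : Set (FullIdx n → ℝ)} (hA : MeasurableSet A) :
    invMeasure n (A ∩ posCone n) = invMeasure n A := by
  rw [invMeasure_apply hA, invMeasure_apply (hA.inter (isOpen_posCone n).measurableSet),
    inter_assoc, inter_self]

lemma symOf_one {n : ℕ} [NeZero n] : symOf (coords (1 : Matrix (Fin n) (Fin n) ℝ)) = 1 :=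
  symOf_coords (by rw [Matrix.IsSymm, Matrix.transpose_one])

lemma coord_zero_pos {n : ℕ} [NeZero n] {v : FullIdx n → ℝ} (hv : v ∈ posCone n) :
    0 < v (Sum.inl ()) := by
  have h := (mem_posCone_iff.1 hv).diag_pos (i := 0)
  have h0 : entryIdx (0 : Fin n) 0 = Sum.inl () := by simp [entryIdx]
  rwa [symOf_apply, h0] at h

/-- The part `1 ≤ x_00 < 2` of the space of symmetric matrices. -/
def coordSlab (n : ℕ) : Set (FullIdx n → ℝ) := (fun v => v (Sum.inl ())) ⁻¹' Ico 1 2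

lemma measurableSet_coordSlab (n : ℕ) : MeasurableSet (coordSlab n) :=
  measurable_pi_apply _ measurableSet_Ico

/-- The generators of the simplicial cover lie in the cone, hence are semidefinite, so
`invMeasure_simplicial_lt_top` applies to each piece once the slab is changed. -/
lemma invMeasure_polyCone_lt_top {n : ℕ} [NeZero n]
    {s : Finset (Module.Dual ℝ (FullIdx n → ℝ))} (hint : (interior (polyCone s)).Nonempty)
    (hpsd : ∀ v ∈ polyCone s, (symOf v).PosSemidef) :
    invMeasure n (polyCone s ∩ coordSlab n) < ⊤ := by
  classical
  have hspan : Submodule.span ℝ {x : FullIdx n → ℝ | ∀ l ∈ s, 0 ≤ l x} = ⊤ :=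
    Submodule.eq_top_of_nonempty_interior' _ (hint.mono (interior_mono Submodule.subset_span))
  obtain ⟨V, hV, hcover⟩ := exists_simplicial_cover (ι := FullIdx n)
    (Module.finrank_fintype_fun_eq_card ℝ).symm s hspan
  set T : Finset (FullIdx n → V) :=
    Finset.univ.filter fun b => LinearIndependent ℝ fun a => (b a : FullIdx n → ℝ) with hT
  set Q : (FullIdx n → V) → Set (FullIdx n → ℝ) := fun b =>
    {v | ∃ t : FullIdx n → ℝ, (∀ a, 0 ≤ t a) ∧ ∑ a, t a • (b a : FullIdx n → ℝ) = v} ∩ posCone n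
    with hQ
  have hsub : polyCone s ∩ coordSlab n ∩ posCone n ⊆ ⋃ b ∈ T, (Q b ∩ coordSlab n) := by
    rintro v ⟨⟨hvC, hvS⟩, hvpos⟩
    obtain ⟨b, hb, t, ht, htv⟩ := hcover v hvC
    exact mem_biUnion (Finset.mem_filter.2 ⟨Finset.mem_univ b, hb⟩) ⟨⟨⟨t, ht, htv⟩, hvpos⟩, hvS⟩
  rw [← invMeasure_inter_posCone (isClosed_polyCone.measurableSet.inter
    (measurableSet_coordSlab n))]
  refine (measure_mono hsub).trans_lt ((measure_biUnion_finset_le T _).trans_lt ?_)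
  refine ENNReal.sum_lt_top.2 fun b hb => ?_
  have hli : LinearIndependent ℝ fun a => (b a : FullIdx n → ℝ) := (Finset.mem_filter.1 hb).2
  set B := Module.Basis.mk hli
    (hli.span_eq_top_of_card_eq_finrank' (Module.finrank_fintype_fun_eq_card ℝ).symm).ge with hB
  set Φ : (FullIdx n → ℝ) ≃ₗ[ℝ] (FullIdx n → ℝ) := B.equivFun.symm with hΦ
  have hΦt : ∀ t, Φ t = ∑ a, t a • (b a : FullIdx n → ℝ) := by
    intro t
    rw [hΦ, Module.Basis.equivFun_symm_apply]
    simp [hB]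
  have hQb : Q b = Φ.symm ⁻¹' {t | ∀ a, 0 ≤ t a} ∩ posCone n := by
    rw [hQ]
    simp only
    congr 1
    ext v
    constructor
    · rintro ⟨t, ht, rfl⟩
      rw [← hΦt, mem_preimage, LinearEquiv.symm_apply_apply]
      exact ht
    · intro hv
      exact ⟨Φ.symm v, hv, by rw [← hΦt, LinearEquiv.apply_symm_apply]⟩
  have hΦc : Continuous Φ.symm :=
    LinearMap.continuous_of_finiteDimensional Φ.symm.toLinearMap
  have hnn : MeasurableSet {t : FullIdx n → ℝ | ∀ a, 0 ≤ t a} := by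
    have : {t : FullIdx n → ℝ | ∀ a, 0 ≤ t a} = ⋂ a, {t | 0 ≤ t a} := by
      ext t
      simp
    rw [this]
    exact MeasurableSet.iInter fun a => measurableSet_le measurable_const (measurable_pi_apply a)
  have hQm : MeasurableSet (Q b) := by
    rw [hQb]
    exact (hΦc.measurable hnn).inter (isOpen_posCone n).measurableSet
  have hQcone : ∀ c : ℝ, 0 < c → ∀ v, c • v ∈ Q b ↔ v ∈ Q b := by
    intro c hc v
    rw [hQb]
    refine and_congr ?_ (smul_mem_posCone_iff hc)
    rw [mem_preimage, mem_preimage, map_smul]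
    refine forall_congr' fun a => ?_
    rw [Pi.smul_apply, smul_eq_mul, mul_nonneg_iff_of_pos_left hc]
  have hne : ∀ v ∈ Q b, v ≠ 0 := by
    rintro v hv rfl
    have := coord_zero_pos hv.2
    simp at this
  -- For ψ twice the sup norm of the simplicial coordinates, 1 ≤ ψ < 2 places the largest coordinate
  -- in [1/2, 1).
  have hslice := invMeasure_slice_le hQm hQcone (φ := fun v => v (Sum.inl ()))
    (ψ := fun v => 2 * ‖Φ.symm v‖) (measurable_pi_apply _)
    (continuous_const.mul hΦc.norm).measurable (fun c _ v => rfl)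
    (fun c hc v => by rw [map_smul, norm_smul, Real.norm_of_nonneg hc.le]; ring)
    (fun v hv => mul_pos two_pos (norm_pos_iff.2 fun h =>
      hne v hv (by simpa using h)))
  refine hslice.trans_lt (lt_of_le_of_lt (measure_mono ?_)
    (invMeasure_simplicial_lt_top (Φ := Φ.toLinearMap) Φ.injective fun a => ?_))
  · rintro v ⟨hv, h1, h2⟩
    rw [hQb] at hv
    refine ⟨Φ.symm v, ⟨hv.1, fun a => ?_, ?_⟩, Φ.apply_symm_apply v⟩
    · have h3 := norm_le_pi_norm (Φ.symm v) a
      have h4 := le_abs_self (Φ.symm v a)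
      rw [Real.norm_eq_abs] at h3
      linarith
    · by_contra! hlt
      have h3 : ‖Φ.symm v‖ < 1 / 2 := by
        rw [pi_norm_lt_iff (by norm_num)]
        intro a
        rw [Real.norm_of_nonneg (hv.1 a)]
        exact hlt a
      linarith
  · refine hpsd _ ?_
    have : Φ (Pi.single a 1) = (b a : FullIdx n → ℝ) := by
      rw [hΦt]
      simp [Pi.single_apply]
    rw [LinearEquiv.coe_coe, this]
    exact hV _ (b a).2

lemma trace_pos_of_posSemidef {n : ℕ} [NeZero n] {W : FullIdx n → ℝ} (hW : (symOf W).PosSemidef)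
    (hW0 : W ≠ 0) : 0 < (symOf W).trace := by
  refine lt_of_le_of_ne hW.trace_nonneg fun h => hW0 (symOf_injective ?_)
  rw [map_zero]
  exact hW.trace_eq_zero_iff.1 h.symm

/-- The entry x_00 may vanish at `W`, but the trace does not. A multiple of the trace with value 3/2
at `W` puts a neighbourhood of `W` into its slab, which is then exchanged for the slab of x_00. -/
lemma invMeasure_polyCone_eq_top {n : ℕ} [NeZero n]
    {s : Finset (Module.Dual ℝ (FullIdx n → ℝ))} {W : FullIdx n → ℝ}
    (hWC : W ∈ interior (polyCone s)) (hW : (symOf W).PosSemidef) (hWpos : W ∉ posCone n)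
    (hW0 : W ≠ 0) : invMeasure n (polyCone s ∩ coordSlab n) = ⊤ := by
  have htr := trace_pos_of_posSemidef hW hW0
  set r : ℝ := 3 / 2 / (symOf W).trace
  have hr : 0 < r := by positivity
  set φ : (FullIdx n → ℝ) → ℝ := fun v => r * (symOf v).trace
  have hφ : Continuous φ := continuous_const.mul continuous_symOf.matrix_trace
  have hφW : φ W = 3 / 2 := div_mul_cancel₀ _ htr.ne'
  have hU : interior (polyCone s) ∩ φ ⁻¹' Ioo 1 2 ∈ 𝓝 W :=
    (isOpen_interior.inter (isOpen_Ioo.preimage hφ)).mem_nhds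
      ⟨hWC, by rw [mem_preimage, hφW]; norm_num⟩
  have hK : MeasurableSet (polyCone s ∩ posCone n) :=
    isClosed_polyCone.measurableSet.inter (isOpen_posCone n).measurableSet
  have hslice := invMeasure_slice_le hK
    (fun c hc v => and_congr (smul_mem_polyCone_iff hc) (smul_mem_posCone_iff hc))
    (φ := φ) (ψ := fun v => v (Sum.inl ())) hφ.measurable (measurable_pi_apply _)
    (fun c _ v => by simp only [φ, map_smul, Matrix.trace_smul, smul_eq_mul]; ring)
    (fun c _ v => rfl) (fun v hv => coord_zero_pos hv.2)
  rw [← top_le_iff]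
  calc ⊤ = invMeasure n (interior (polyCone s) ∩ φ ⁻¹' Ioo 1 2) :=
        (invMeasure_eq_top_of_mem_nhds hW hWpos hU).symm
    _ ≤ invMeasure n (polyCone s ∩ φ ⁻¹' Ico 1 2) :=
        measure_mono (inter_subset_inter interior_subset (preimage_mono Ioo_subset_Ico_self))
    _ = invMeasure n (polyCone s ∩ φ ⁻¹' Ico 1 2 ∩ posCone n) :=
        (invMeasure_inter_posCone (isClosed_polyCone.measurableSet.inter
          (hφ.measurable measurableSet_Ico))).symm
    _ = invMeasure n (polyCone s ∩ posCone n ∩ φ ⁻¹' Ico 1 2) := by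
        rw [inter_right_comm]
    _ ≤ invMeasure n (polyCone s ∩ posCone n ∩ coordSlab n) := hslice
    _ ≤ invMeasure n (polyCone s ∩ coordSlab n) :=
        measure_mono (inter_subset_inter_left _ inter_subset_left)

/-- A convex set which meets the positive cone in its interior and contains a matrix that is not
positive semidefinite has a nonzero boundary point of the positive cone in its interior. -/
lemma exists_boundary_mem_interior {n : ℕ} [NeZero n] (hn : 2 ≤ n) {C : Set (FullIdx n → ℝ)}
    (hC : Convex ℝ C) (hpos : (interior C ∩ posCone n).Nonempty) {X : FullIdx n → ℝ}
    (hX : X ∈ C) (hXpsd : ¬ (symOf X).PosSemidef) :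
    ∃ W ∈ interior C, (symOf W).PosSemidef ∧ W ∉ posCone n ∧ W ≠ 0 := by
  -- `Y` off the line of `X` keeps the segment away from 0. Such a `Y` exists because the space has
  -- dimension greater than 1 for n ≥ 2.
  obtain ⟨Y, ⟨hYC, hYpos⟩, hYX⟩ :
      ∃ Y ∈ interior C ∩ posCone n, Y ∉ Submodule.span ℝ {X} := by
    by_contra! h
    have hO : IsOpen (interior C ∩ posCone n) := isOpen_interior.inter (isOpen_posCone n)
    have htop : Submodule.span ℝ {X} = ⊤ := Submodule.eq_top_of_nonempty_interior' _
      (hpos.mono (hO.subset_interior_iff.2 h))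
    have h1 : Module.finrank ℝ (Submodule.span ℝ {X}) ≤ 1 :=
      (finrank_span_le_card ({X} : Set (FullIdx n → ℝ))).trans (by simp)
    rw [htop, finrank_top, Module.finrank_fintype_fun_eq_card] at h1
    have h2 := card_fullIdx (n := n)
    nlinarith
  -- Otherwise the disjoint open sets of positive definite and of non-semidefinite matrices would
  -- disconnect the segment.
  obtain ⟨W, hWseg, hWpsd, hWpos⟩ :
      ∃ W ∈ segment ℝ Y X, (symOf W).PosSemidef ∧ W ∉ posCone n := by
    by_contra! h
    obtain ⟨z, -, hz1, hz2⟩ := (convex_segment (𝕜 := ℝ) Y X).isPreconnected (posCone n)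
      {v | (symOf v).PosSemidef}ᶜ (isOpen_posCone n) (isClosed_setOf_posSemidef n).isOpen_compl
      (fun z hz => by
        by_cases hzp : (symOf z).PosSemidef
        · exact Or.inl (h z hz hzp)
        · exact Or.inr hzp)
      ⟨Y, left_mem_segment ℝ Y X, hYpos⟩ ⟨X, right_mem_segment ℝ Y X, hXpsd⟩
    exact hz2 (mem_posCone_iff.1 hz1).posSemidef
  obtain ⟨a, b, ha, hb, hab, rfl⟩ := hWseg
  have ha0 : 0 < a := by
    refine ha.lt_of_ne fun h => hXpsd ?_
    subst h
    rw [zero_add] at hab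
    subst hab
    simpa using hWpsd
  refine ⟨_, hC.combo_interior_self_mem_interior hYC hX ha0 hb hab, hWpsd, hWpos, fun h0 => hYX ?_⟩
  have : Y = (-(a⁻¹ * b)) • X := by
    have h1 : a • Y = -(b • X) := eq_neg_of_add_eq_zero_left h0
    rw [← inv_smul_smul₀ ha0.ne' Y, h1, smul_neg, smul_smul, neg_smul]
  rw [this]
  exact Submodule.smul_mem _ _ (Submodule.mem_span_singleton_self X)

/-- Near a nonzero boundary point of the positive cone there are matrices which are neither
positive nor negative semidefinite. -/
lemma exists_indefinite_of_boundary {n : ℕ} [NeZero n] {C : Set (FullIdx n → ℝ)}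
    {W : FullIdx n → ℝ} (hWC : W ∈ interior C) (hW : (symOf W).PosSemidef) (hWpos : W ∉ posCone n)
    (hW0 : W ≠ 0) : ∃ v ∈ C, ¬ (symOf v).PosSemidef ∧ ¬ (symOf (-v)).PosSemidef := by
  have htr := trace_pos_of_posSemidef hW hW0
  set I : FullIdx n → ℝ := coords 1
  have hc : Continuous fun ε : ℝ => W - ε • I :=
    continuous_const.sub (continuous_id.smul continuous_const)
  have h1 : ∀ᶠ ε : ℝ in 𝓝 0, W - ε • I ∈ interior C :=
    hc.continuousAt.eventually_mem (isOpen_interior.mem_nhds (by simpa using hWC))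
  have h2 : ∀ᶠ ε : ℝ in 𝓝 0, 0 < (symOf (W - ε • I)).trace :=
    (continuous_symOf.comp hc).matrix_trace.continuousAt.eventually
      (lt_mem_nhds (by simpa using htr))
  obtain ⟨ε, ⟨hε1, hε2⟩, hε⟩ :=
    ((h1.and h2).filter_mono nhdsWithin_le_nhds |>.and self_mem_nhdsWithin).exists
      (f := 𝓝[>] (0 : ℝ))
  -- If W - εI were semidefinite, W would be definite; the trace, still positive, excludes its
  -- negative.
  refine ⟨W - ε • I, interior_subset hε1, fun h => hWpos ?_, fun h => ?_⟩
  · have h3 : (symOf W) = symOf (W - ε • I) + ε • (1 : Matrix (Fin n) (Fin n) ℝ) := by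
      rw [map_sub, map_smul, symOf_one]
      abel
    rw [mem_posCone_iff, h3]
    exact Matrix.PosDef.posSemidef_add h (Matrix.PosDef.one.smul hε)
  · have h4 := h.trace_nonneg
    rw [map_neg, Matrix.trace_neg] at h4
    linarith

/-- The cone criterion, for a cone which meets the positive cone. -/
lemma invMeasure_lt_top_iff_of_nonempty {n : ℕ} [NeZero n] (hn : 2 ≤ n)
    {s : Finset (Module.Dual ℝ (FullIdx n → ℝ))}
    (hint : (interior {v | v ∈ polyCone s ∨ -v ∈ polyCone s}).Nonempty)
    (hne : (polyCone s ∩ posCone n).Nonempty) :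
    invMeasure n ({v | v ∈ polyCone s ∨ -v ∈ polyCone s} ∩ coordSlab n) < ⊤ ↔
      ∀ v ∈ polyCone s, (symOf v).PosSemidef ∨ (symOf (-v)).PosSemidef := by
  -- Projective full-dimensionality concerns the union of the cone and its negative; two closed sets
  -- with empty interior have a union with empty interior.
  have hint' : (interior (polyCone s)).Nonempty := by
    rw [Set.nonempty_iff_ne_empty]
    intro h0
    have h1 : interior ((Homeomorph.neg (FullIdx n → ℝ)) ⁻¹' polyCone s) = ∅ := by
      rw [← Homeomorph.preimage_interior, h0, preimage_empty]
    have h2 := interior_union_isClosed_of_interior_empty (isClosed_polyCone (s := s)) h1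
    rw [h0] at h2
    exact hint.ne_empty h2
  have hne' : (interior (polyCone s) ∩ posCone n).Nonempty := by
    obtain ⟨X, hXC, hXpos⟩ := hne
    have hX : X ∈ closure (interior (polyCone s)) := by
      rw [convex_polyCone.closure_interior_eq_closure_of_nonempty_interior hint']
      exact subset_closure hXC
    rw [inter_comm]
    exact mem_closure_iff.1 hX _ (isOpen_posCone n) hXpos
  constructor
  · intro hfin v hv
    by_contra! hv'
    obtain ⟨W, hWC, hW, hWpos, hW0⟩ :=
      exists_boundary_mem_interior hn convex_polyCone hne' hv hv'.1
    have htop := invMeasure_polyCone_eq_top hWC hW hWpos hW0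
    have hle : invMeasure n (polyCone s ∩ coordSlab n)
        ≤ invMeasure n ({v | v ∈ polyCone s ∨ -v ∈ polyCone s} ∩ coordSlab n) :=
      measure_mono (inter_subset_inter_left _ fun v hv => Or.inl hv)
    rw [htop, top_le_iff] at hle
    exact hfin.ne hle
  · intro hall
    -- The projective hypothesis allows a sign depending on `v`. A wrong sign would force a boundary
    -- crossing, and indefinite matrices near it.
    have hpsd : ∀ v ∈ polyCone s, (symOf v).PosSemidef := by
      intro v hv
      by_contra hv'
      obtain ⟨W, hWC, hW, hWpos, hW0⟩ :=
        exists_boundary_mem_interior hn convex_polyCone hne' hv hv'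
      obtain ⟨w, hw, hw1, hw2⟩ := exists_indefinite_of_boundary hWC hW hWpos hW0
      exact (hall w hw).elim hw1 hw2
    have hm : MeasurableSet (polyCone s ∩ coordSlab n) :=
      isClosed_polyCone.measurableSet.inter (measurableSet_coordSlab n)
    have hmn : MeasurableSet ({v | v ∈ polyCone s ∨ -v ∈ polyCone s} ∩ coordSlab n) :=
      (isClosed_polyCone.union
        (isClosed_polyCone.preimage continuous_neg)).measurableSet.inter (measurableSet_coordSlab n)
    rw [← invMeasure_inter_posCone hmn]
    refine lt_of_le_of_lt (measure_mono ?_) (invMeasure_polyCone_lt_top hint' hpsd)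
    rintro v ⟨⟨hv | hv, hvS⟩, hvpos⟩
    · exact ⟨hv, hvS⟩
    · exfalso
      have h1 := (hpsd _ hv).trace_nonneg
      have h2 := (mem_posCone_iff.1 hvpos).trace_pos
      rw [map_neg, Matrix.trace_neg] at h1
      linarith

lemma mem_polyCone_image_neg {n : ℕ} [DecidableEq (Module.Dual ℝ (FullIdx n → ℝ))]
    {s : Finset (Module.Dual ℝ (FullIdx n → ℝ))} {v : FullIdx n → ℝ} :
    v ∈ polyCone (s.image fun l => -l) ↔ -v ∈ polyCone s := by
  simp [polyCone]

/-- The cone criterion, for a cone which meets the positive or the negative cone. -/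
lemma invMeasure_lt_top_iff {n : ℕ} [NeZero n] (hn : 2 ≤ n)
    {s : Finset (Module.Dual ℝ (FullIdx n → ℝ))}
    (hint : (interior {v | v ∈ polyCone s ∨ -v ∈ polyCone s}).Nonempty)
    (hne : ({v | v ∈ polyCone s ∨ -v ∈ polyCone s} ∩ posCone n).Nonempty) :
    invMeasure n ({v | v ∈ polyCone s ∨ -v ∈ polyCone s} ∩ coordSlab n) < ⊤ ↔
      ∀ v ∈ polyCone s, (symOf v).PosSemidef ∨ (symOf (-v)).PosSemidef := by
  classical
  obtain ⟨X, hX | hX, hXpos⟩ := hne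
  · exact invMeasure_lt_top_iff_of_nonempty hn hint ⟨X, hX, hXpos⟩
  -- Negating all functionals swaps the cone with its negative and leaves the polytope unchanged.
  · set s' := s.image fun l => -l
    have hs : {v | v ∈ polyCone s ∨ -v ∈ polyCone s} = {v | v ∈ polyCone s' ∨ -v ∈ polyCone s'} := by
      ext v
      simp only [mem_ofPred_eq, s', mem_polyCone_image_neg, neg_neg]
      exact or_comm
    rw [hs] at hint ⊢
    rw [invMeasure_lt_top_iff_of_nonempty hn hint ⟨X, mem_polyCone_image_neg.2 hX, hXpos⟩]
    constructor
    · intro h v hv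
      have := h (-v) (mem_polyCone_image_neg.2 (by rwa [neg_neg]))
      rw [neg_neg] at this
      exact this.symm
    · intro h v hv
      have := h (-v) (mem_polyCone_image_neg.1 hv)
      rw [neg_neg] at this
      exact this.symm

/-! ### From cones back to projective polytopes -/

/-- Coordinates on `Sym_n(ℝ)`. -/
def symEquiv (n : ℕ) [NeZero n] : (FullIdx n → ℝ) ≃ₗ[ℝ] SymMat n where
  toFun v := ⟨symOf v, isSymm_symOf v⟩
  map_add' _ _ := Subtype.ext (map_add _ _ _)
  map_smul' _ _ := Subtype.ext (map_smul _ _ _)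
  invFun A := coords A
  left_inv v := coords_symOf v
  right_inv A := Subtype.ext (symOf_coords A.2)

@[simp] lemma coe_symEquiv {n : ℕ} [NeZero n] (v : FullIdx n → ℝ) :
    (symEquiv n v : Matrix (Fin n) (Fin n) ℝ) = symOf v := rfl

lemma continuous_symEquiv {n : ℕ} [NeZero n] : Continuous (symEquiv n) :=
  continuous_symOf.subtype_mk _

/-- The projective polytope with given inequalities. -/
def projPolytope {n : ℕ} (s : Finset (Module.Dual ℝ (SymMat n))) : Set (ℙ ℝ (SymMat n)) :=
  {p | ∃ (X : SymMat n) (hX : X ≠ 0), (∀ l ∈ s, 0 ≤ l X) ∧ p = Projectivization.mk ℝ X hX}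

lemma smul_mem_cone_or_neg {n : ℕ} {c : ℝ} (hc : c ≠ 0) {v : FullIdx n → ℝ}
    {r : Finset (Module.Dual ℝ (FullIdx n → ℝ))} (h : v ∈ polyCone r ∨ -v ∈ polyCone r) :
    c • v ∈ polyCone r ∨ -(c • v) ∈ polyCone r := by
  rcases lt_or_gt_of_ne hc with hc | hc
  · have h1 : c • v = (-c) • -v := by rw [neg_smul_neg]
    have h2 : -(c • v) = (-c) • v := by rw [neg_smul]
    rw [h2, smul_mem_polyCone_iff (neg_pos.2 hc), h1, smul_mem_polyCone_iff (neg_pos.2 hc)]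
    exact h.symm
  · rw [← smul_neg, smul_mem_polyCone_iff hc, smul_mem_polyCone_iff hc]
    exact h

section

variable {n : ℕ} [NeZero n]

/-- The inequalities of a polytope in coordinates. -/
def pullback [DecidableEq (Module.Dual ℝ (FullIdx n → ℝ))]
    (s : Finset (Module.Dual ℝ (SymMat n))) : Finset (Module.Dual ℝ (FullIdx n → ℝ)) :=
  s.image fun l => l ∘ₗ (symEquiv n).toLinearMap

variable [DecidableEq (Module.Dual ℝ (FullIdx n → ℝ))] {s : Finset (Module.Dual ℝ (SymMat n))}

lemma mem_polyCone_pullback {v : FullIdx n → ℝ} :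
    v ∈ polyCone (pullback s) ↔ ∀ l ∈ s, 0 ≤ l (symEquiv n v) := by
  simp [polyCone, pullback]

/-- Representatives are determined up to a nonzero scalar, whose sign decides between the cone and
its negative. -/
lemma symEquiv_mem_representatives {v : FullIdx n → ℝ} :
    symEquiv n v ∈ representatives (projPolytope s) ↔
      v ≠ 0 ∧ (v ∈ polyCone (pullback s) ∨ -v ∈ polyCone (pullback s)) := by
  constructor
  · rintro ⟨hv, X, hX, hXs, hmk⟩
    obtain ⟨a, ha⟩ := (Projectivization.mk_eq_mk_iff' ℝ _ _ hv hX).1 hmk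
    have ha0 : a ≠ 0 := by
      rintro rfl
      rw [zero_smul] at ha
      exact hv ha.symm
    refine ⟨fun h => hv (by rw [h, map_zero]), ?_⟩
    have hv' : v = a • (symEquiv n).symm X := by
      rw [← map_smul, ha, LinearEquiv.symm_apply_apply]
    rw [hv']
    refine smul_mem_cone_or_neg ha0 (Or.inl (mem_polyCone_pullback.2 ?_))
    simpa using hXs
  · rintro ⟨hv, h⟩
    have hv' : symEquiv n v ≠ 0 := (LinearEquiv.map_ne_zero_iff _).2 hv
    refine ⟨hv', ?_⟩
    rcases h with h | h
    · exact ⟨_, hv', mem_polyCone_pullback.1 h, rfl⟩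
    · refine ⟨symEquiv n (-v), (LinearEquiv.map_ne_zero_iff _).2 (neg_ne_zero.2 hv),
        mem_polyCone_pullback.1 h, ?_⟩
      exact (Projectivization.mk_eq_mk_iff' ℝ _ _ _ _).2 ⟨-1, by simp⟩

lemma hypParam_mem_toHypModel {x : CoordIdx n → ℝ} (hx : (affineMatrix x).PosDef) :
    hypParam x ∈ toHypModel (projPolytope s ∩ projModel n) ↔
      ((Sum.elim (fun _ => 1) x : FullIdx n → ℝ) ∈ polyCone (pullback s) ∨
        -(Sum.elim (fun _ => 1) x : FullIdx n → ℝ) ∈ polyCone (pullback s)) := by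
  have hd : 0 < (affineMatrix x).det := hx.det_pos
  set κ := (affineMatrix x).det ^ (-(1 : ℝ) / (n : ℝ)) with hκ
  have hκ0 : 0 < κ := Real.rpow_pos_of_pos hd _
  set v : FullIdx n → ℝ := Sum.elim (fun _ => 1) x
  have hv : hypParam x = symOf (κ • v) := by
    rw [map_smul, ← affineMatrix_eq_symOf]
    rfl
  have hpos : κ • v ∈ posCone n := by
    rw [mem_posCone_iff, ← hv]
    exact hx.smul hκ0
  have hne : κ • v ≠ 0 := fun h => by
    have := coord_zero_pos hpos
    rw [h] at this
    exact lt_irrefl _ this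
  constructor
  · rintro ⟨-, Y, ⟨hY, hYP, -⟩, hYx⟩
    have hYv : Y = symEquiv n (κ • v) := Subtype.ext (by rw [hYx, hv, coe_symEquiv])
    subst hYv
    have h := smul_mem_cone_or_neg (inv_ne_zero hκ0.ne')
      (symEquiv_mem_representatives.1 ⟨hY, hYP⟩).2
    rwa [inv_smul_smul₀ hκ0.ne'] at h
  · intro h
    obtain ⟨hY, hYP⟩ := symEquiv_mem_representatives.2 ⟨hne, smul_mem_cone_or_neg hκ0.ne' h⟩
    refine ⟨⟨hx.smul hκ0, ?_⟩, symEquiv n (κ • v), ⟨hY, hYP, _, hY, hpos, rfl⟩, ?_⟩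
    · have hn : (n : ℝ) ≠ 0 := Nat.cast_ne_zero.2 (NeZero.ne n)
      rw [hypParam, Matrix.det_smul, Fintype.card_fin, ← Real.rpow_natCast, ← Real.rpow_mul hd.le,
        div_mul_cancel₀ _ hn, Real.rpow_neg hd.le, Real.rpow_one, inv_mul_cancel₀ hd.ne']
    · rw [coe_symEquiv, hv]

/-- The density formula turns the volume into a positive constant times the invariant integral over
the slice x_00 = 1, and the slice is traded for the slab. -/
lemma riemannianVolume_lt_top_iff :
    riemannianVolume (toHypModel (projPolytope s ∩ projModel n)) < ⊤ ↔
      invMeasure n ({v | v ∈ polyCone (pullback s) ∨ -v ∈ polyCone (pullback s)} ∩ coordSlab n)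
        < ⊤ := by
  set K : Set (FullIdx n → ℝ) := {v | v ∈ polyCone (pullback s) ∨ -v ∈ polyCone (pullback s)}
    with hK
  have hKm : MeasurableSet K :=
    (isClosed_polyCone.union (isClosed_polyCone.preimage continuous_neg)).measurableSet
  have hcone : ∀ c : ℝ, 0 < c → ∀ v, c • v ∈ K ↔ v ∈ K := fun c hc v => by
    refine or_congr (smul_mem_polyCone_iff hc) ?_
    rw [← smul_neg]
    exact smul_mem_polyCone_iff hc
  have hset : {x : CoordIdx n → ℝ | (affineMatrix x).PosDef ∧
      hypParam x ∈ toHypModel (projPolytope s ∩ projModel n)}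
      = {x | (Sum.elim (fun _ => 1) x : FullIdx n → ℝ) ∈ K ∩ posCone n} := by
    ext x
    simp only [mem_ofPred_eq, mem_inter_iff, mem_posCone_iff, ← affineMatrix_eq_symOf]
    constructor
    · rintro ⟨h1, h2⟩
      exact ⟨(hypParam_mem_toHypModel h1).1 h2, h1⟩
    · rintro ⟨h1, h2⟩
      exact ⟨h2, (hypParam_mem_toHypModel h2).2 h1⟩
  obtain ⟨c, hc, hgram⟩ := sqrt_det_gramMatrix (n := n)
  have hmeas1 : Measurable fun x : CoordIdx n → ℝ =>
      (Sum.elim (fun _ => 1) x : FullIdx n → ℝ) := by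
    refine measurable_pi_lambda _ fun a => ?_
    rcases a with ⟨⟩ | a
    · exact measurable_const
    · exact measurable_pi_apply a
  have hms : MeasurableSet
      {x : CoordIdx n → ℝ | (Sum.elim (fun _ => 1) x : FullIdx n → ℝ) ∈ K ∩ posCone n} :=
    hmeas1 (hKm.inter (isOpen_posCone n).measurableSet)
  have hvol : riemannianVolume (toHypModel (projPolytope s ∩ projModel n))
      = ENNReal.ofReal c * ∫⁻ x in {x : CoordIdx n → ℝ | Sum.elim (fun _ => 1) x ∈ K ∩ posCone n},
        invDensity (affineMatrix x) := by
    rw [riemannianVolume, hset, ← lintegral_const_mul' _ _ ENNReal.ofReal_ne_top]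
    refine setLIntegral_congr_fun hms fun x hx => ?_
    have hpd : (affineMatrix x).PosDef := by
      rw [affineMatrix_eq_symOf]
      exact hx.2
    rw [hgram x hpd, ENNReal.ofReal_mul hc.le]
    rfl
  rw [coordSlab, ← lintegral_slice_lt_top_iff hKm hcone, hvol]
  refine ⟨fun h => ?_, fun h => ENNReal.mul_lt_top ENNReal.ofReal_lt_top h⟩
  by_contra hI
  rw [not_lt_top_iff] at hI
  rw [hI, ENNReal.mul_top (ENNReal.ofReal_pos.2 hc).ne'] at h
  exact lt_irrefl _ h

lemma projPolytope_subset_satake_iff :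
    projPolytope s ⊆ satakeCompactification n ↔
      ∀ v ∈ polyCone (pullback s), (symOf v).PosSemidef ∨ (symOf (-v)).PosSemidef := by
  constructor
  · intro h v hv
    by_cases hv0 : v = 0
    · subst hv0
      left
      rw [map_zero]
      exact Matrix.PosSemidef.zero
    obtain ⟨hY, hYP⟩ := symEquiv_mem_representatives.2 ⟨hv0, Or.inl hv⟩
    obtain ⟨X, hX, hXpsd, hmk⟩ := h hYP
    obtain ⟨a, ha⟩ := (Projectivization.mk_eq_mk_iff' ℝ _ _ hY hX).1 hmk
    have hva : symOf v = a • (X : Matrix (Fin n) (Fin n) ℝ) := by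
      rw [← coe_symEquiv, ← ha]
      rfl
    rw [map_neg, hva, ← neg_smul]
    rcases le_total 0 a with h0 | h0
    · exact Or.inl (hXpsd.smul h0)
    · exact Or.inr (hXpsd.smul (neg_nonneg.2 h0))
  · rintro h p ⟨X, hX, hXs, rfl⟩
    have hXv : (X : Matrix (Fin n) (Fin n) ℝ) = symOf ((symEquiv n).symm X) := by
      rw [← coe_symEquiv, LinearEquiv.apply_symm_apply]
    have hv : (symEquiv n).symm X ∈ polyCone (pullback s) :=
      mem_polyCone_pullback.2 (by simpa using hXs)
    rcases h _ hv with h1 | h1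
    · exact ⟨X, hX, by rwa [hXv], rfl⟩
    · refine ⟨-X, neg_ne_zero.2 hX, ?_, ?_⟩
      · rw [map_neg, ← hXv] at h1
        exact h1
      · exact (Projectivization.mk_eq_mk_iff' ℝ _ _ _ _).2 ⟨-1, by simp⟩

end

/-- There are no affine coordinates, so Lebesgue measure is the unit mass at one point. -/
lemma riemannianVolume_one_lt_top (S : Set (Matrix (Fin 1) (Fin 1) ℝ)) :
    riemannianVolume S < ⊤ := by
  have : IsEmpty (CoordIdx 1) := ⟨fun a => a.2.2 (by omega)⟩
  refine (setLIntegral_le_lintegral _ _).trans_lt ?_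
  rw [lintegral_unique, volume_pi, Measure.pi_of_empty, Measure.dirac_apply_of_mem (mem_univ _),
    mul_one]
  exact ENNReal.ofReal_lt_top

lemma posSemidef_or_neg_of_one (v : FullIdx 1 → ℝ) :
    (symOf v).PosSemidef ∨ (symOf (-v)).PosSemidef := by
  have key : ∀ w : FullIdx 1 → ℝ, 0 ≤ symOf w 0 0 → (symOf w).PosSemidef := by
    intro w hw
    have : symOf w = Matrix.diagonal fun _ => symOf w 0 0 := by
      ext i j
      rw [Subsingleton.elim i 0, Subsingleton.elim j 0, Matrix.diagonal_apply_eq]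
    rw [this]
    exact Matrix.PosSemidef.diagonal fun _ => hw
  rcases le_total 0 (symOf v 0 0) with h | h
  · exact Or.inl (key v h)
  · refine Or.inr (key (-v) ?_)
    rw [map_neg]
    exact neg_nonneg.2 h

end SatakePolytope

end

theorem propositionB1 (n : ℕ) (P : Set (ℙ ℝ (SatakePolytope.SymMat n)))
    (hP : SatakePolytope.IsProjPolytope P)
    (hfull : SatakePolytope.IsFullDimensional P)
    (hne : (P ∩ SatakePolytope.projModel n).Nonempty) :
    SatakePolytope.riemannianVolume
        (SatakePolytope.toHypModel (P ∩ SatakePolytope.projModel n)) < ⊤ ↔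
      P ⊆ SatakePolytope.satakeCompactification n := by
  classical
  obtain ⟨s, rfl⟩ := hP
  change (SatakePolytope.projPolytope s ∩ _).Nonempty at hne
  change SatakePolytope.IsFullDimensional (SatakePolytope.projPolytope s) at hfull
  change SatakePolytope.riemannianVolume (SatakePolytope.toHypModel
    (SatakePolytope.projPolytope s ∩ _)) < ⊤ ↔ SatakePolytope.projPolytope s ⊆ _
  obtain ⟨_, hpP, X, hX, hXpos, rfl⟩ := hne
  -- In size 0 there is no nonzero symmetric matrix, contradicting nonemptiness.
  rcases Nat.eq_zero_or_pos n with rfl | hn0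
  · exact absurd (Subtype.ext (Subsingleton.elim _ _)) hX
  have : NeZero n := ⟨hn0.ne'⟩
  rw [SatakePolytope.projPolytope_subset_satake_iff]
  -- Size 1 is separate because the positive cone then has no nonzero boundary point; both sides
  -- hold trivially.
  rcases Nat.eq_or_lt_of_le (show 1 ≤ n from hn0) with hn1 | hn2
  · have h1 : n = 1 := hn1.symm
    subst h1
    exact iff_of_true (SatakePolytope.riemannianVolume_one_lt_top _)
      fun v _ => SatakePolytope.posSemidef_or_neg_of_one v
  rw [SatakePolytope.riemannianVolume_lt_top_iff]
  refine SatakePolytope.invMeasure_lt_top_iff hn2 ?_ ?_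
  · obtain ⟨Y, hY⟩ := hfull
    refine ⟨(SatakePolytope.symEquiv n).symm Y, ?_⟩
    refine mem_interior.2 ⟨SatakePolytope.symEquiv n ⁻¹' interior
      (SatakePolytope.representatives (SatakePolytope.projPolytope s)), fun v hv => ?_,
      isOpen_interior.preimage SatakePolytope.continuous_symEquiv, by simpa using hY⟩
    exact (SatakePolytope.symEquiv_mem_representatives.1 (interior_subset hv)).2
  · refine ⟨(SatakePolytope.symEquiv n).symm X, ?_, ?_⟩
    · refine (SatakePolytope.symEquiv_mem_representatives (s := s).1 ?_).2
      rw [LinearEquiv.apply_symm_apply]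
      exact ⟨hX, hpP⟩
    · rw [SatakePolytope.mem_posCone_iff, ← SatakePolytope.coe_symEquiv,
        LinearEquiv.apply_symm_apply]
      exact hXpos
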